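/- For a topological space $X$ and $k\ge 1$, let $\exp_k(X)$ be the set of nonempty finite subsets of $X$ of cardinality at most $k$, with the quotient topology from the surjection $X^k\to\exp_k(X)$, $(x_1,\dots,x_k)\mapsto\{x_1\}\cup\dots\cup\{x_k\}$. For $l\le k$ there is a natural inclusion $\exp_l(X)\subseteq\exp_k(X)$; put $\exp_0(X)=\emptyset$. Let $k\ge 2$ and give $Y_k=\exp_k(S^1)\setminus\exp_{k-2}(S^1)$ the subspace topology of $\exp_k(S^1)$, where $S^1=\{\lambda\in\mathbb{C}:|\lambda|=1\}$. Take as basepoint the set $\{\lambda^k=1\}$ of $k$-th roots of unity. Let $\gamma$ be the path in $Y_k$ from $\{\lambda^k=1\}$ to $\{\lambda^{k-1}=1\}$ which is the image, under $(x_1,\dots,x_k)\mapsto\{e^{2\pi i x_1},\dots,e^{2\pi i x_k}\}$, of the linear homotopy from $\left(0,\tfrac1k,\dots,\tfrac{k-1}k\right)$ to $\left(0,0,\tfrac1{k-1},\dots,\tfrac{k-2}{k-1}\right)$. Let $\alpha$ be the loop that rotates the $k$-th roots of unity anticlockwise through $2\pi/k$, and let $\beta$ be the loop based at $\{\lambda^k=1\}$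 that follows $\gamma$ to $\{\lambda^{k-1}=1\}$, then rotates the $(k-1)$-th roots of unity anticlockwise through $2\pi/(k-1)$, and then follows $\gamma$ back. Theorem. For every $k\ge 2$, $\pi_1(Y_k,\{\lambda^k=1\})$ has the presentation $\langle\alpha,\beta\mid\alpha^k=\beta^{k-1}\rangle$; that is, there is an isomorphism from the group $\langle a,b\mid a^k=b^{k-1}\rangle$ onto $\pi_1(Y_k,\{\lambda^k=1\})$ that sends $a$ to $[\alpha]$ and $b$ to $[\beta]$. -/

import Mathlib

open scoped unitInterval

noncomputable section

/-- The `k`-th finite subset space of `X`: nonempty finite subsets of cardinality at most `k`. -/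
@[ext]
structure FinSubsetSpace (k : ℕ) (X : Type*) where
  carrier : Set X
  nonempty : carrier.Nonempty
  finite : carrier.Finite
  ncard_le : carrier.ncard ≤ k

namespace FinSubsetSpace

variable {X : Type*} {k l : ℕ}

/-- The natural map `X ^ k → exp_k X`, `(x₁, …, x_k) ↦ {x₁} ∪ ⋯ ∪ {x_k}`. -/
def ofTuple [NeZero k] (x : Fin k → X) : FinSubsetSpace k X :=
  ⟨Set.range x, Set.range_nonempty x, Set.finite_range x, by
    rw [← Set.image_univ]
    exact (Set.ncard_image_le Set.finite_univ).trans (by simp)⟩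

/-- `exp_k X` carries the quotient topology from `X ^ k`. -/
instance [NeZero k] [TopologicalSpace X] : TopologicalSpace (FinSubsetSpace k X) :=
  TopologicalSpace.coinduced (ofTuple (k := k) (X := X)) inferInstance

theorem continuous_ofTuple [NeZero k] [TopologicalSpace X] :
    Continuous (ofTuple (k := k) (X := X)) :=
  continuous_coinduced_rng

theorem exists_ofTuple [NeZero k] (S : FinSubsetSpace k X) : ∃ x : Fin k → X, ofTuple x = S := by
  obtain ⟨S, ⟨a, ha⟩, hf, hc⟩ := S
  have : Fintype S := hf.fintype
  have hc' : Fintype.card S ≤ Fintype.card (Fin k) := by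
    rw [Fintype.card_fin]
    rwa [← Nat.card_coe_set_eq, Nat.card_eq_fintype_card] at hc
  obtain ⟨f⟩ := Function.Embedding.nonempty_of_card_le hc'
  have : Nonempty S := ⟨⟨a, ha⟩⟩
  refine ⟨fun i => (Function.invFun f i : S), FinSubsetSpace.ext ?_⟩
  change Set.range (Subtype.val ∘ Function.invFun f) = S
  rw [Set.range_comp, (Function.invFun_surjective f.injective).range_eq]
  simp

/-- The natural inclusion `exp_l X ↪ exp_k X` for `l ≤ k`. -/
def incl (h : l ≤ k) (S : FinSubsetSpace l X) : FinSubsetSpace k X :=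
  ⟨S.carrier, S.nonempty, S.finite, S.ncard_le.trans h⟩

theorem notMem_range_incl (h : l ≤ k) (S : FinSubsetSpace k X) :
    S ∉ Set.range (incl (X := X) h) ↔ l < S.carrier.ncard := by
  constructor
  · intro hS
    by_contra! hc
    exact hS ⟨⟨S.carrier, S.nonempty, S.finite, hc⟩, rfl⟩
  · rintro hS ⟨T, rfl⟩
    exact absurd T.ncard_le (not_le.mpr hS)

end FinSubsetSpace

namespace CircleSubsets

open FinSubsetSpace

/-- The complement `exp_k(S¹) ∖ exp_{k-2}(S¹)`, with the subspace topology
(`exp_0(S¹)` is empty). -/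
abbrev StratumCompl (k : ℕ) : Type :=
  {S : FinSubsetSpace k Circle //
    S ∉ Set.range (incl (X := Circle) (l := k - 2) (k := k) (Nat.sub_le k 2))}

/-- The covering map `ℝ → S¹`, `x ↦ exp (2πix)`. -/
def e (x : ℝ) : Circle := Circle.exp (2 * Real.pi * x)

theorem continuous_e : Continuous e := by
  unfold e; fun_prop

theorem e_add (x y : ℝ) : e (x + y) = e x * e y := by
  simp [e, mul_add]

theorem e_zero : e 0 = 1 := by simp [e]

theorem e_int (m : ℤ) : e m = 1 := Circle.exp_two_pi_mul_int m

theorem e_pow (x : ℝ) (n : ℕ) : e x ^ n = e (n * x) := by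
  induction n with
  | zero => simp [e_zero]
  | succ n ih => rw [pow_succ, ih, ← e_add]; push_cast; ring_nf

theorem e_injOn : Set.InjOn e (Set.Ico 0 1) := by
  intro x hx y hy hxy
  have hp := Real.two_pi_pos
  have h := Circle.exp_injOn_Ico (a := 0) (b := 2 * Real.pi) (by simp)
    (show 2 * Real.pi * x ∈ _ from ⟨by have := hx.1; positivity, by nlinarith [hx.2]⟩)
    (show 2 * Real.pi * y ∈ _ from ⟨by have := hy.1; positivity, by nlinarith [hy.2]⟩) hxy
  exact mul_left_cancel₀ hp.ne' h

/-- The set of `n`-th roots of unity on the circle. -/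
def rootSet (n : ℕ) : Set Circle := {z | z ^ n = 1}

theorem range_eq_rootSet (n : ℕ) (hn : n ≠ 0) :
    Set.range (fun i : Fin n => e ((i : ℕ) / n)) = rootSet n := by
  have hn' : (n : ℝ) ≠ 0 := Nat.cast_ne_zero.mpr hn
  ext z
  constructor
  · rintro ⟨i, rfl⟩
    change e _ ^ n = 1
    rw [e_pow, mul_div_cancel₀ _ hn']
    exact_mod_cast e_int (i : ℕ)
  · intro hz
    obtain ⟨θ, rfl⟩ := Circle.exp_surjective z
    have hp := Real.two_pi_pos
    obtain ⟨x, rfl⟩ : ∃ x, θ = 2 * Real.pi * x := ⟨θ / (2 * Real.pi), by field_simp⟩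
    change e x ^ n = 1 at hz
    rw [e_pow, e, Circle.exp_eq_one] at hz
    obtain ⟨m, hm⟩ := hz
    have hx : n * x = m := by
      have : (2 * Real.pi) * (n * x) = (2 * Real.pi) * m := by rw [hm]; ring
      exact mul_left_cancel₀ hp.ne' this
    have hn0 : (n : ℤ) ≠ 0 := by exact_mod_cast hn
    have h0 := Int.emod_nonneg m hn0
    have h1 := Int.emod_lt_of_pos m (b := n) (by omega)
    refine ⟨⟨(m % n).toNat, by omega⟩, ?_⟩
    change e _ = e x
    have h2 : (((m % n).toNat : ℕ) : ℝ) = ((m % n : ℤ) : ℝ) := by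
      exact_mod_cast Int.toNat_of_nonneg h0
    have h3 : (m : ℝ) = n * ((m / n : ℤ) : ℝ) + ((m % n : ℤ) : ℝ) := by
      exact_mod_cast (Int.mul_ediv_add_emod m n).symm
    have h4 : x = ((m % n : ℤ) : ℝ) / n + ((m / n : ℤ) : ℝ) := by
      field_simp
      linarith
    simp only [h2]
    rw [h4, e_add, e_int, mul_one]

theorem ncard_rootSet (n : ℕ) (hn : n ≠ 0) : (rootSet n).ncard = n := by
  have hn' : (0 : ℝ) < n := by positivity
  have hi : Function.Injective (fun i : Fin n => e ((i : ℕ) / n)) := by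
    intro i j hij
    have key : ∀ i : Fin n, ((i : ℕ) : ℝ) / n ∈ Set.Ico (0 : ℝ) 1 := fun i =>
      ⟨by positivity, by rw [div_lt_one hn']; exact_mod_cast i.2⟩
    have := e_injOn (key i) (key j) hij
    rw [div_left_inj' hn'.ne'] at this
    exact Fin.ext (by exact_mod_cast this)
  rw [← range_eq_rootSet n hn, ← Nat.card_coe_set_eq, Nat.card_range_of_injective hi]
  simp

variable (k : ℕ) [hk : k.AtLeastTwo]

/-- The `n`-th roots of unity as a point of `exp_k(S¹) ∖ exp_{k-2}(S¹)`, for `n = k - 1, k`. -/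
def rootsPt (n : ℕ) (h₁ : k - 1 ≤ n) (h₂ : n ≤ k) : StratumCompl k :=
  have hk2 : 2 ≤ k := hk.prop
  have hc : (rootSet n).ncard = n := ncard_rootSet n (by omega)
  ⟨⟨rootSet n, ⟨1, show (1 : Circle) ^ n = 1 from one_pow n⟩, Set.finite_of_ncard_pos (by omega), by omega⟩, by
    rw [notMem_range_incl]
    change _ < (rootSet n).ncard
    omega⟩

variable {k}

/-- Multiplication by `c ∈ S¹` (rotation of the circle), acting on subsets of the circle. -/
def rotate (c : Circle) (S : StratumCompl k) : StratumCompl k :=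
  have hc : ((c * ·) '' S.1.carrier).ncard = S.1.carrier.ncard :=
    Set.ncard_image_of_injective _ (mul_right_injective c)
  ⟨⟨(c * ·) '' S.1.carrier, S.1.nonempty.image _, S.1.finite.image _, by rw [hc]; exact S.1.ncard_le⟩, by
    have h := S.2
    rw [notMem_range_incl] at h ⊢
    exact h.trans_eq hc.symm⟩

theorem continuous_rotate (S : StratumCompl k) : Continuous (fun c => rotate c S) := by
  obtain ⟨x, hx⟩ := exists_ofTuple S.1
  refine Continuous.subtype_mk
    (f := fun c => (rotate c S).1) ?_ (fun c => (rotate c S).2)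
  have : (fun c => (rotate c S).1) = fun c => ofTuple (fun i => c * x i) := by
    funext c
    refine FinSubsetSpace.ext ?_
    change (c * ·) '' S.1.carrier = Set.range ((c * ·) ∘ x)
    rw [Set.range_comp, ← hx]
    rfl
  rw [this]
  exact continuous_ofTuple.comp (by fun_prop)

variable (k)

/-- The loop rotating the `n`-th roots of unity anticlockwise through `2π / n`
(for `n = k - 1, k`): at time `t` they are rotated through the angle `2πt / n`. -/
def rotLoop (n : ℕ) (h₁ : k - 1 ≤ n) (h₂ : n ≤ k) :
    Path (rootsPt k n h₁ h₂) (rootsPt k n h₁ h₂) where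
  toFun t := rotate (e ((t : ℝ) / n)) (rootsPt k n h₁ h₂)
  continuous_toFun := (continuous_rotate _).comp (continuous_e.comp (by fun_prop))
  source' := by
    refine Subtype.ext (FinSubsetSpace.ext ?_)
    change (e (((0 : I) : ℝ) / n) * ·) '' rootSet n = rootSet n
    simp [e_zero]
  target' := by
    have hk2 : 2 ≤ k := hk.prop
    have hn : (n : ℝ) ≠ 0 := Nat.cast_ne_zero.mpr (by omega)
    have hr : e (((1 : I) : ℝ) / n) ^ n = 1 := by
      rw [e_pow, Set.Icc.coe_one, mul_div_cancel₀ _ hn]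
      exact_mod_cast e_int 1
    refine Subtype.ext (FinSubsetSpace.ext ?_)
    change (e (((1 : I) : ℝ) / n) * ·) '' rootSet n = rootSet n
    ext z
    constructor
    · rintro ⟨w, hw, rfl⟩
      change (_ * w) ^ n = 1
      rw [mul_pow, hr, one_mul]
      exact hw
    · intro hz
      refine ⟨(e (((1 : I) : ℝ) / n))⁻¹ * z, ?_, by simp⟩
      change (_ * z) ^ n = 1
      rw [mul_pow, inv_pow, hr, inv_one, one_mul]
      exact hz

/-- The linear homotopy from `(0, 1/k, …, (k-1)/k)` to `(0, 0, 1/(k-1), …, (k-2)/(k-1))`.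
Coordinates are indexed by `0, …, k - 1`; the truncated subtraction `i - 1` gives the
two zeros at `i = 0, 1`. -/
def gammaTuple (t : I) (i : Fin k) : ℝ :=
  (1 - (t : ℝ)) * (((i : ℕ) : ℝ) / k) +
    (t : ℝ) * ((((i : ℕ) - 1 : ℕ) : ℝ) / ((k - 1 : ℕ) : ℝ))

theorem gammaTuple_lt (t : I) {i j : Fin k} (hi : 1 ≤ (i : ℕ)) (hij : i < j) :
    gammaTuple k t i < gammaTuple k t j := by
  have hk2 : 2 ≤ k := hk.prop
  have hk0 : (0 : ℝ) < k := by exact_mod_cast (by omega : 0 < k)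
  have hk1 : (0 : ℝ) < ((k - 1 : ℕ) : ℝ) := by exact_mod_cast (by omega : 0 < k - 1)
  have hij' : (i : ℕ) < j := hij
  have h1 : ((i : ℕ) : ℝ) / k < ((j : ℕ) : ℝ) / k := by
    gcongr
  have h2 : (((i : ℕ) - 1 : ℕ) : ℝ) / ((k - 1 : ℕ) : ℝ) <
      (((j : ℕ) - 1 : ℕ) : ℝ) / ((k - 1 : ℕ) : ℝ) := by
    have : (i : ℕ) - 1 < (j : ℕ) - 1 := by omega
    gcongr
  have ht0 := t.2.1
  have ht1 := t.2.2
  unfold gammaTuple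
  rcases ht0.eq_or_lt with h | h
  · rw [← h]; simpa using h1
  · nlinarith

theorem gammaTuple_mem (t : I) (i : Fin k) : gammaTuple k t i ∈ Set.Ico (0 : ℝ) 1 := by
  have hk2 : 2 ≤ k := hk.prop
  have hk0 : (0 : ℝ) < k := by exact_mod_cast (by omega : 0 < k)
  have hk1 : (0 : ℝ) < ((k - 1 : ℕ) : ℝ) := by exact_mod_cast (by omega : 0 < k - 1)
  have ht0 : (0 : ℝ) ≤ t := t.2.1
  have ht1 : (0 : ℝ) ≤ 1 - t := by have := t.2.2; linarith
  have hi := i.2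
  have h1 : ((i : ℕ) : ℝ) / k < 1 := by
    rw [div_lt_one hk0]; exact_mod_cast hi
  have h2 : (((i : ℕ) - 1 : ℕ) : ℝ) / ((k - 1 : ℕ) : ℝ) < 1 := by
    rw [div_lt_one hk1]; exact_mod_cast (by omega : (i : ℕ) - 1 < k - 1)
  unfold gammaTuple
  refine ⟨by positivity, ?_⟩
  rcases ht0.eq_or_lt with h | h
  · rw [← h]; simpa using h1
  · nlinarith

theorem le_ncard_range_gamma (t : I) :
    k - 2 < (Set.range fun i : Fin k => e (gammaTuple k t i)).ncard := by
  have hk2 : 2 ≤ k := hk.prop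
  let f : Fin (k - 1) → Circle := fun i => e (gammaTuple k t ⟨i + 1, by omega⟩)
  have hf : Function.Injective f := by
    intro i j hij
    have h := e_injOn (gammaTuple_mem k t _) (gammaTuple_mem k t _) hij
    rcases lt_trichotomy i j with hl | hl | hl
    · exact absurd h (gammaTuple_lt k t (by simp) (by simpa using hl)).ne
    · exact hl
    · exact absurd h (gammaTuple_lt k t (by simp) (by simpa using hl)).ne'
  have hc : (Set.range f).ncard = k - 1 := by
    rw [← Nat.card_coe_set_eq, Nat.card_range_of_injective hf]; simp
  have hsub : Set.range f ⊆ Set.range fun i : Fin k => e (gammaTuple k t i) := by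
    rintro _ ⟨i, rfl⟩
    exact ⟨_, rfl⟩
  have := Set.ncard_le_ncard hsub (Set.finite_range _)
  omega

/-- The path `γ` from the `k`-th to the `(k-1)`-th roots of unity: the image in `exp_k(S¹)`
of the linear homotopy `gammaTuple`. -/
def gammaPath :
    Path (rootsPt k k (Nat.sub_le k 1) le_rfl) (rootsPt k (k - 1) le_rfl (Nat.sub_le k 1)) where
  toFun t := ⟨ofTuple fun i => e (gammaTuple k t i), by
    rw [notMem_range_incl]; exact le_ncard_range_gamma k t⟩
  continuous_toFun := by
    refine Continuous.subtype_mk (continuous_ofTuple.comp ?_) _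
    refine continuous_pi fun i => continuous_e.comp ?_
    unfold gammaTuple
    fun_prop
  source' := by
    have hk2 : 2 ≤ k := hk.prop
    refine Subtype.ext (FinSubsetSpace.ext ?_)
    change (Set.range fun i : Fin k => e (gammaTuple k 0 i)) = rootSet k
    rw [← range_eq_rootSet k (by omega)]
    simp [gammaTuple]
  target' := by
    have hk2 : 2 ≤ k := hk.prop
    refine Subtype.ext (FinSubsetSpace.ext ?_)
    change (Set.range fun i : Fin k => e (gammaTuple k 1 i)) = rootSet (k - 1)
    rw [← range_eq_rootSet (k - 1) (by omega)]
    ext z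
    constructor
    · rintro ⟨i, rfl⟩
      exact ⟨⟨(i : ℕ) - 1, by omega⟩, by simp [gammaTuple]⟩
    · rintro ⟨i, rfl⟩
      exact ⟨⟨(i : ℕ) + 1, by omega⟩, by simp [gammaTuple]⟩

/-- The basepoint: the `k`-th roots of unity. -/
def basept : StratumCompl k := rootsPt k k (Nat.sub_le k 1) le_rfl

/-- The loop `α`, rotating the `k`-th roots of unity anticlockwise through `2π / k`. -/
def alpha : Path (basept k) (basept k) := rotLoop k k (Nat.sub_le k 1) le_rfl

/-- The loop `β`: follow `γ` to the `(k-1)`-th roots of unity, rotate anticlockwise through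
`2π / (k-1)`, and follow `γ` back. -/
def beta : Path (basept k) (basept k) :=
  ((gammaPath k).trans (rotLoop k (k - 1) le_rfl (Nat.sub_le k 1))).trans (gammaPath k).symm

/-- The group `⟨a, b | a ^ k = b ^ (k-1)⟩`, with `a = of 0` and `b = of 1`. -/
abbrev TorusKnotGroup (k : ℕ) : Type :=
  PresentedGroup
    ({FreeGroup.of 0 ^ k * (FreeGroup.of 1 ^ (k - 1))⁻¹} : Set (FreeGroup (Fin 2)))

end CircleSubsets

end

/-!
Let `Y` be the space of subsets of the circle with `k` or `k - 1` elements. The group of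
`Y` is computed from a convex space of lifts rather than from a van Kampen theorem.

A `k`-element subset lifts to a strictly increasing sequence `x : ℤ → ℝ` with
`x (i + k) = x i + 1`, unique up to a shift of the index. A `(k - 1)`-element subset lifts to such
a sequence in which one entry per period is doubled. The set `LiftSeq k` of all these sequences is
convex, hence simply connected, and `subsetOf : LiftSeq k → Y` is surjective. Its fibres are
generated by two moves (`fiber_induction`): the shift of a `k`-periodic sequence, and the shift of
a `(k - 1)`-periodic sequence seen through doubling the entries of index `0`. The loop `α` is the
image of a path realizing the first move and `β` that of a path realizing the second. Performing
`k` moves of the first kind or `k - 1` of the second translates a doubled sequence by `1`, whence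
`α ^ k = β ^ (k - 1)` (`rotClass_pow_eq`).

The local structure of `Y` enters only through the collapse: if `S` lies in a small neighbourhood
of `S₀`, then moving every point of `S` linearly to the nearest point of `S₀` stays in `Y`, and
it lifts to a straight segment in `LiftSeq k` from any lift `x` of `S` to a lift of `S₀`.

* Generation (`closure_eq_top`). Collapsing shows that a path inside a small neighbourhood is
  homotopic to the image of two segments of lifts. Subdividing a loop therefore writes it as a
  product of images of segments, joined by changes of lift within a fibre, and these changes
  contribute words in `α` and `β`.

* Injectivity (`injective_of_map_eq`). For `a ^ k = b ^ (k - 1)` in a group `G` there is a function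
  `potential` on lifts that is multiplied by `a` or `b` under the two moves. The
  ratio of its values at a lift and at the collapsed lift depends only on `S` and `S₀`; these ratios
  are transition functions of a covering of `Y` with fibre `G`, on which the potential makes every
  path of lifts liftable. The monodromy of `α` and `β` is left multiplication by `a` and `b`.
  For `G = ⟨a, b | a ^ k = b ^ (k - 1)⟩` this is the regular representation, so a word that is
  trivial in the fundamental group is trivial in `G`.
-/

noncomputable section

namespace CircleSubsets

open FinSubsetSpace Topology

/-! ### Periodic lifts of subsets of the circle -/

theorem e_eq_iff {x y : ℝ} : e x = e y ↔ ∃ n : ℤ, x = y + n := by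
  have hp := Real.two_pi_pos
  rw [e, e, Circle.exp_eq_exp]
  refine exists_congr fun n => ⟨fun h => ?_, fun h => by rw [h]; ring⟩
  have : 2 * Real.pi * x = 2 * Real.pi * (y + n) := by rw [h]; ring
  exact mul_left_cancel₀ hp.ne' this

theorem e_add_int (x : ℝ) (n : ℤ) : e (x + n) = e x := e_eq_iff.2 ⟨n, rfl⟩

theorem e_surjective : Function.Surjective e := by
  intro z
  obtain ⟨θ, rfl⟩ := Circle.exp_surjective z
  have hp := Real.two_pi_pos
  exact ⟨θ / (2 * Real.pi), by rw [e]; congr 1; field_simp⟩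

theorem isOpenMap_e : IsOpenMap e := by
  have h := isLocalHomeomorph_circleExp.isOpenMap
  have h2 : IsOpenMap fun x : ℝ => 2 * Real.pi * x :=
    (Homeomorph.mulLeft₀ (2 * Real.pi) Real.two_pi_pos.ne').isOpenMap
  exact h.comp h2

/-- Sequences `x : ℤ → ℝ` with `x (i + m) = x i + 1`, i.e. lifts of cyclic `m`-tuples. -/
def IsPeriodic (m : ℕ) (x : ℤ → ℝ) : Prop := ∀ i, x (i + m) = x i + 1

theorem IsPeriodic.add_mul {m : ℕ} {x : ℤ → ℝ} (h : IsPeriodic m x) (i n : ℤ) :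
    x (i + m * n) = x i + n := by
  induction n with
  | zero => simp
  | succ n ih =>
    have := h (i + m * n)
    rw [ih] at this
    rw [show i + (m : ℤ) * (n + 1) = i + m * n + m by ring, this]
    push_cast; ring
  | pred n ih =>
    have := h (i + m * (-n - 1))
    rw [show i + (m : ℤ) * (-n - 1) + m = i + m * -n by ring, ih] at this
    push_cast at this ⊢
    linarith

theorem IsPeriodic.shift {m : ℕ} {x : ℤ → ℝ} (h : IsPeriodic m x) (n : ℤ) :
    IsPeriodic m fun i => x (i + n) := fun i => by
  change x (i + m + n) = x (i + n) + 1
  rw [show i + m + n = i + n + m by ring]; exact h _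

theorem IsPeriodic.eq_emod {m : ℕ} {x : ℤ → ℝ} (h : IsPeriodic m x) (i : ℤ) :
    x i = x (i % m) + (i / m : ℤ) := by
  rw [← h.add_mul, Int.emod_add_mul_ediv]

theorem IsPeriodic.range_fin {m : ℕ} {x : ℤ → ℝ} (h : IsPeriodic m x) (hm : 0 < m) :
    (Set.range fun i : Fin m => e (x i)) = Set.range (e ∘ x) := by
  ext z
  constructor
  · rintro ⟨i, rfl⟩; exact ⟨i, rfl⟩
  · rintro ⟨i, rfl⟩
    have h0 := Int.emod_nonneg i (b := m) (by omega)
    have h1 := Int.emod_lt_of_pos i (b := m) (by omega)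
    refine ⟨⟨(i % m).toNat, by omega⟩, ?_⟩
    simp only [Function.comp_apply, Int.toNat_of_nonneg h0]
    rw [h.eq_emod i, e_add_int]

/-- A periodic sequence enumerates the full preimage of its image on the circle. -/
theorem IsPeriodic.preimage_range {m : ℕ} {x : ℤ → ℝ} (h : IsPeriodic m x) :
    e ⁻¹' Set.range (e ∘ x) = Set.range x := by
  ext t
  constructor
  · rintro ⟨i, hi⟩
    obtain ⟨n, hn⟩ := e_eq_iff.1 hi.symm
    exact ⟨i + m * n, by rw [h.add_mul, hn]⟩
  · rintro ⟨i, rfl⟩; exact ⟨i, rfl⟩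

/-- Lifts to `ℝ` of `m`-element subsets of the circle: strictly increasing sequences
`w : ℤ → ℝ` with `w (i + m) = w i + 1`. -/
def StrictSeq (m : ℕ) : Set (ℤ → ℝ) := {w | StrictMono w ∧ IsPeriodic m w}

theorem StrictSeq.pos {m : ℕ} {w : ℤ → ℝ} (hw : w ∈ StrictSeq m) : 0 < m := by
  rcases Nat.eq_zero_or_pos m with rfl | h
  · have := hw.2 0; simp at this
  · exact h

theorem StrictSeq.ncard_range {m : ℕ} {w : ℤ → ℝ} (hw : w ∈ StrictSeq m) :
    (Set.range (e ∘ w)).ncard = m := by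
  have hm := StrictSeq.pos hw
  rw [← hw.2.range_fin hm, ← Nat.card_coe_set_eq, Nat.card_range_of_injective, Nat.card_fin]
  intro i j hij
  obtain ⟨n, hn⟩ := e_eq_iff.1 hij
  rw [← hw.2.add_mul] at hn
  have h := hw.1.injective hn
  have h2 : ((i : ℕ) : ℤ) % m = (j : ℕ) % m := by rw [h]; simp
  rw [Int.emod_eq_of_lt (by omega) (by omega), Int.emod_eq_of_lt (by omega) (by omega)] at h2
  exact Fin.ext (by exact_mod_cast h2)

theorem StrictSeq.shift {m : ℕ} {w : ℤ → ℝ} (hw : w ∈ StrictSeq m) (n : ℤ) :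
    (fun i => w (i + n)) ∈ StrictSeq m :=
  ⟨fun i j h => hw.1 (by omega), hw.2.shift n⟩

/-- Every nonempty finite subset of the circle has a strictly increasing periodic lift: list its
arguments in `[0, 1)` in increasing order and continue periodically. -/
theorem exists_strictSeq {S : Set Circle} (hS : S.Finite) (hne : S.Nonempty) :
    ∃ w ∈ StrictSeq S.ncard, Set.range (e ∘ w) = S := by
  have himg : e '' (e ⁻¹' S ∩ Set.Ico 0 1) = S := by
    ext z
    constructor
    · rintro ⟨t, ht, rfl⟩; exact ht.1
    · intro hz
      obtain ⟨t, rfl⟩ := e_surjective z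
      have : e (Int.fract t) = e t := e_eq_iff.2 ⟨-⌊t⌋, by push_cast; rw [← Int.self_sub_floor]; ring⟩
      exact ⟨Int.fract t, ⟨by rw [Set.mem_preimage, this]; exact hz, Int.fract_nonneg t,
        Int.fract_lt_one t⟩, this⟩
  have hinj : Set.InjOn e (e ⁻¹' S ∩ Set.Ico 0 1) := e_injOn.mono Set.inter_subset_right
  have hfin : (e ⁻¹' S ∩ Set.Ico 0 1).Finite := Set.Finite.of_finite_image (by rwa [himg]) hinj
  have hcard : hfin.toFinset.card = S.ncard := by
    rw [← Set.ncard_eq_toFinset_card _ hfin, ← hinj.ncard_image, himg]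
  have hm : 0 < S.ncard := (Set.ncard_pos hS).2 hne
  generalize S.ncard = m at hcard hm
  let f := hfin.toFinset.orderEmbOfFin hcard
  have hf : ∀ i, f i ∈ e ⁻¹' S ∩ Set.Ico 0 1 := fun i =>
    hfin.mem_toFinset.1 (Finset.orderEmbOfFin_mem _ hcard i)
  have hmod : ∀ i : ℤ, 0 ≤ i % m ∧ i % m < m := fun i =>
    ⟨Int.emod_nonneg i (by omega), Int.emod_lt_of_pos i (by omega)⟩
  let r : ℤ → Fin m := fun i => ⟨(i % m).toNat, by have := hmod i; omega⟩
  let w : ℤ → ℝ := fun i => f (r i) + (i / m : ℤ)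
  have hper : IsPeriodic m w := by
    intro i
    have h1 : r (i + m) = r i := by ext; simp [r]
    have h2 : (i + m) / (m : ℤ) = i / m + 1 := by
      rw [Int.add_ediv_of_dvd_right (dvd_refl _), Int.ediv_self (by omega)]
    simp only [w, h1, h2]; push_cast; ring
  have hmono : StrictMono w := by
    refine strictMono_int_of_lt_succ fun i => ?_
    have h3 := Int.emod_add_mul_ediv i m
    have hi := hmod i
    by_cases hlt : i % m + 1 < m
    · have h4 : (i + 1) / (m : ℤ) = i / m ∧ (i + 1) % m = i % m + 1 := by
        rw [Int.ediv_emod_unique (by omega)]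
        refine ⟨by linarith, by omega, hlt⟩
      have : r i < r (i + 1) := by
        rw [Fin.lt_def]; simp only [r, h4.2]; omega
      simp only [w, h4.1]
      simpa using this
    · have h4 : (i + 1) / (m : ℤ) = i / m + 1 ∧ (i + 1) % m = 0 := by
        rw [Int.ediv_emod_unique (by omega)]
        refine ⟨?_, by omega, by omega⟩
        have : i % m + 1 = m := by omega
        rw [mul_add]; linarith
      have h5 := (hf (r i)).2.2
      have h6 := (hf (r (i + 1))).2.1
      simp only [w, h4.1]; push_cast; linarith
  refine ⟨w, ⟨hmono, hper⟩, ?_⟩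
  rw [← hper.range_fin hm, ← himg]
  ext z
  constructor
  · rintro ⟨i, rfl⟩
    exact ⟨f (r i), hf _, by simp [w, e_add_int]⟩
  · rintro ⟨t, ht, rfl⟩
    have : t ∈ Set.range f := by
      rw [Finset.range_orderEmbOfFin]; simpa using ht
    obtain ⟨i, rfl⟩ := this
    refine ⟨i, ?_⟩
    have hi : r (i : ℕ) = i := by
      ext; simp only [r]; rw [Int.emod_eq_of_lt (by omega) (by omega)]; simp
    change e (f (r _) + _) = _
    rw [e_add_int, hi]

/-- A monotone surjection of `ℤ` moves by at most one in each step. -/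
theorem monotone_surjective_succ_le {s : ℤ → ℤ} (hm : Monotone s) (hs : Function.Surjective s)
    (i : ℤ) : s (i + 1) ≤ s i + 1 := by
  by_contra! h
  obtain ⟨j, hj⟩ := hs (s i + 1)
  rcases le_or_gt j i with hji | hji
  · have := hm hji; omega
  · have := hm (show i + 1 ≤ j by omega); omega

theorem monotone_surjective_sub_le {s : ℤ → ℤ} (hm : Monotone s) (hs : Function.Surjective s)
    {i j : ℤ} (hij : i ≤ j) : s j - s i ≤ j - i := by
  induction j, hij using Int.leInduction with
  | base => simp
  | succ j _ ih => have := monotone_surjective_succ_le hm hs j; omega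

/-- If a monotone sequence has the same values as a strictly increasing one, it is obtained from
it by a monotone surjective reparametrization. -/
theorem exists_reparam {x w : ℤ → ℝ} (hx : Monotone x) (hw : StrictMono w)
    (h : Set.range x = Set.range w) :
    ∃ s : ℤ → ℤ, Monotone s ∧ Function.Surjective s ∧ ∀ i, x i = w (s i) := by
  have hex : ∀ i, ∃ j, w j = x i := fun i => by
    have : x i ∈ Set.range w := h ▸ ⟨i, rfl⟩
    exact this
  choose s hs using hex
  refine ⟨s, fun i j hij => ?_, fun j => ?_, fun i => (hs i).symm⟩
  · rw [← hw.le_iff_le, hs, hs]; exact hx hij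
  · have : w j ∈ Set.range x := h ▸ ⟨j, rfl⟩
    obtain ⟨i, hi⟩ := this
    exact ⟨i, hw.injective (by rw [hs, hi])⟩

/-- Two strictly increasing sequences with the same values differ by a shift. -/
theorem exists_shift_of_range_eq {x w : ℤ → ℝ} (hx : StrictMono x) (hw : StrictMono w)
    (h : Set.range x = Set.range w) : ∃ n : ℤ, ∀ i, x i = w (i + n) := by
  obtain ⟨s, hm, hs, hxs⟩ := exists_reparam hx.monotone hw h
  have hstrict : StrictMono s := fun i j hij => by
    have := hx hij; rw [hxs, hxs] at this; exact hw.lt_iff_lt.1 this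
  have hsucc : ∀ i, s (i + 1) = s i + 1 := fun i => by
    have := monotone_surjective_succ_le hm hs i
    have := hstrict (show i < i + 1 by omega)
    omega
  refine ⟨s 0, fun i => ?_⟩
  rw [hxs]
  congr 1
  induction i with
  | zero => simp
  | succ i ih => rw [hsucc, ih]; ring
  | pred i ih => have := hsucc (-i - 1); rw [sub_add_cancel, ih] at this; omega

/-- Weakly increasing sequences `x : ℤ → ℝ` with `x (i + k) = x i + 1` in which the
coincidences `x (i + 1) = x i` occur in at most one residue class modulo `k`. -/
def LiftSeq (k : ℕ) : Set (ℤ → ℝ) :=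
  {x | Monotone x ∧ IsPeriodic k x ∧
    ∀ i j, x (i + 1) = x i → x (j + 1) = x j → (k : ℤ) ∣ j - i}

theorem StrictSeq.mem_liftSeq {k : ℕ} {w : ℤ → ℝ} (hw : w ∈ StrictSeq k) : w ∈ LiftSeq k :=
  ⟨hw.1.monotone, hw.2, fun i _ h => absurd h (hw.1 (by omega)).ne'⟩

theorem LiftSeq.shift {k : ℕ} {x : ℤ → ℝ} (hx : x ∈ LiftSeq k) (n : ℤ) :
    (fun i => x (i + n)) ∈ LiftSeq k := by
  refine ⟨fun i j h => hx.1 (by omega), hx.2.1.shift n, fun i j hi hj => ?_⟩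
  have := hx.2.2 (i + n) (j + n)
  rw [show j + n - (i + n) = j - i by ring] at this
  refine this ?_ ?_
  · rw [show i + n + 1 = i + 1 + n by ring]; exact hi
  · rw [show j + n + 1 = j + 1 + n by ring]; exact hj

/-- In a convex combination of two monotone sequences a coincidence comes from coincidences in
both (unless a coefficient vanishes), so imposing few coincidences is a convex condition. -/
theorem convex_liftSeq (k : ℕ) : Convex ℝ (LiftSeq k) := by
  intro x hx y hy a b ha hb hab
  refine ⟨fun i j h => ?_, fun i => ?_, fun i j hi hj => ?_⟩
  · have h1 := hx.1 h
    have h2 := hy.1 h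
    simp only [Pi.add_apply, Pi.smul_apply, smul_eq_mul]
    gcongr
  · simp only [Pi.add_apply, Pi.smul_apply, smul_eq_mul, hx.2.1 i, hy.2.1 i]
    linear_combination hab
  · have key : ∀ i, (a • x + b • y) (i + 1) = (a • x + b • y) i →
        a * (x (i + 1) - x i) = 0 ∧ b * (y (i + 1) - y i) = 0 := by
      intro i hi
      simp only [Pi.add_apply, Pi.smul_apply, smul_eq_mul] at hi
      have h1 := mul_nonneg ha (sub_nonneg.2 (hx.1 (show i ≤ i + 1 by omega)))
      have h2 := mul_nonneg hb (sub_nonneg.2 (hy.1 (show i ≤ i + 1 by omega)))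
      constructor <;> linarith
    obtain ⟨hxi, hyi⟩ := key i hi
    obtain ⟨hxj, hyj⟩ := key j hj
    rcases ha.eq_or_lt with rfl | ha
    · have hb1 : b = 1 := by linarith
      subst hb1
      exact hy.2.2 i j (by linarith) (by linarith)
    · refine hx.2.2 i j ?_ ?_
      · have := (mul_eq_zero.1 hxi).resolve_left ha.ne'; linarith
      · have := (mul_eq_zero.1 hxj).resolve_left ha.ne'; linarith

theorem convex_strictSeq (m : ℕ) : Convex ℝ (StrictSeq m) := by
  intro x hx y hy a b ha hb hab
  refine ⟨fun i j h => ?_, fun i => ?_⟩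
  · have h1 := hx.1 h
    have h2 := hy.1 h
    simp only [Pi.add_apply, Pi.smul_apply, smul_eq_mul]
    rcases ha.eq_or_lt with rfl | ha
    · have hb1 : b = 1 := by linarith
      subst hb1; linarith
    · nlinarith
  · simp only [Pi.add_apply, Pi.smul_apply, smul_eq_mul, hx.2 i, hy.2 i]
    linear_combination hab

/-- The reparametrization `i ↦ i - ⌈i / k⌉` of `ℤ`: it takes the values `0, 0, 1, …, k - 2` at
`0, 1, …, k - 1`. -/
def dupIndex (k : ℕ) (i : ℤ) : ℤ := i + -i / k

section

variable {k : ℕ} [hk : k.AtLeastTwo]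

theorem two_le_of_atLeastTwo (k : ℕ) [hk : k.AtLeastTwo] : 2 ≤ k := hk.prop

theorem pos_of_atLeastTwo (k : ℕ) [hk : k.AtLeastTwo] : 0 < k := by
  have := hk.prop; omega

theorem sub_one_pos_of_atLeastTwo (k : ℕ) [hk : k.AtLeastTwo] : 0 < k - 1 := by
  have := hk.prop; omega

theorem dupIndex_succ_of_dvd {i : ℤ} (hi : (k : ℤ) ∣ i) : dupIndex k (i + 1) = dupIndex k i := by
  have hk2 := two_le_of_atLeastTwo k
  obtain ⟨q, rfl⟩ := hi
  have h1 : -((k : ℤ) * q) / k = -q := by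
    rw [← mul_neg, Int.mul_ediv_cancel_left _ (by omega)]
  have h2 : -((k : ℤ) * q + 1) / k = -q - 1 ∧ -((k : ℤ) * q + 1) % k = k - 1 := by
    rw [Int.ediv_emod_unique (by omega)]
    exact ⟨by ring, by omega, by omega⟩
  simp only [dupIndex, h1, h2.1]; ring

theorem dupIndex_succ_of_not_dvd {i : ℤ} (hi : ¬ (k : ℤ) ∣ i) :
    dupIndex k (i + 1) = dupIndex k i + 1 := by
  have hk2 := two_le_of_atLeastTwo k
  have h0 := Int.emod_nonneg (-i) (b := k) (by omega)
  have h1 := Int.emod_lt_of_pos (-i) (b := k) (by omega)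
  have h3 := Int.emod_add_mul_ediv (-i) k
  have hne : (-i) % k ≠ 0 := fun h => hi (by simpa using Int.dvd_of_emod_eq_zero h)
  have h2 : -(i + 1) / (k : ℤ) = -i / k ∧ -(i + 1) % (k : ℤ) = -i % k - 1 := by
    rw [Int.ediv_emod_unique (by omega)]
    exact ⟨by linarith, by omega, by omega⟩
  simp only [dupIndex, h2.1]; ring

theorem dupIndex_add_period (i : ℤ) : dupIndex k (i + k) = dupIndex k i + (k - 1 : ℕ) := by
  have hk2 := two_le_of_atLeastTwo k
  have : -(i + k) / (k : ℤ) = -i / k - 1 := by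
    rw [neg_add, ← sub_eq_add_neg, Int.sub_ediv_of_dvd _ (dvd_refl _), Int.ediv_self (by omega)]
  simp only [dupIndex, this]
  push_cast [Nat.cast_sub (show 1 ≤ k by omega)]
  ring

theorem dupIndex_monotone : Monotone (dupIndex k) := by
  refine monotone_int_of_le_succ fun i => ?_
  by_cases h : (k : ℤ) ∣ i
  · exact (dupIndex_succ_of_dvd h).ge
  · rw [dupIndex_succ_of_not_dvd h]; omega

/-- A strictly increasing `(k - 1)`-periodic sequence with its entries of index `≡ 0` doubled,
as a `k`-periodic sequence. -/
def dup (k : ℕ) (w : ℤ → ℝ) : ℤ → ℝ := fun i => w (dupIndex k i)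

theorem dup_mem {w : ℤ → ℝ} (hw : w ∈ StrictSeq (k - 1)) : dup k w ∈ LiftSeq k := by
  refine ⟨hw.1.monotone.comp dupIndex_monotone, fun i => ?_, fun i j hi hj => ?_⟩
  · simp only [dup, dupIndex_add_period]; exact hw.2 _
  · have key : ∀ i, dup k w (i + 1) = dup k w i → (k : ℤ) ∣ i := by
      intro i hi
      by_contra h
      have := hw.1.injective hi
      rw [dupIndex_succ_of_not_dvd h] at this
      omega
    exact dvd_sub (key j hj) (key i hi)

/-- A section of `dupIndex k`, hitting the second of two equal values. -/
def dupSection (k : ℕ) (j : ℤ) : ℤ := 1 + j + j / (k - 1 : ℕ)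

theorem dupSection_dupIndex (i : ℤ) :
    dupSection k (dupIndex k i) = if (k : ℤ) ∣ i then i + 1 else i := by
  have hk2 := two_le_of_atLeastTwo k
  have hc : ((k - 1 : ℕ) : ℤ) = k - 1 := by push_cast [Nat.cast_sub (show 1 ≤ k by omega)]; ring
  have h0 := Int.emod_nonneg (-i) (b := k) (by omega)
  have h1 := Int.emod_lt_of_pos (-i) (b := k) (by omega)
  have h3 := Int.emod_add_mul_ediv (-i) k
  simp only [dupSection, dupIndex, hc]
  set q := -i / (k : ℤ)
  set r := -i % (k : ℤ)
  split_ifs with hd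
  · have hr : r = 0 := Int.emod_eq_zero_of_dvd ((dvd_neg).2 hd)
    have : (i + q) / ((k : ℤ) - 1) = -q := by
      rw [show i + q = ((k : ℤ) - 1) * -q by linarith, Int.mul_ediv_cancel_left _ (by omega)]
    rw [this]; ring
  · have hr : r ≠ 0 := fun h => hd (by simpa using Int.dvd_of_emod_eq_zero h)
    have : (i + q) / ((k : ℤ) - 1) = -q - 1 ∧ (i + q) % ((k : ℤ) - 1) = k - 1 - r := by
      rw [Int.ediv_emod_unique (by omega)]
      exact ⟨by linarith, by omega, by omega⟩
    rw [this.1]; ring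

theorem dupSection_add_period (j : ℤ) :
    dupSection k (j + (k - 1 : ℕ)) = dupSection k j + k := by
  have hk2 := two_le_of_atLeastTwo k
  rw [dupSection, Int.add_ediv_of_dvd_right (dvd_refl _), Int.ediv_self (by omega), dupSection]
  push_cast [Nat.cast_sub (show 1 ≤ k by omega)]
  ring

theorem dupSection_strictMono : StrictMono (dupSection k) := by
  have hk2 := two_le_of_atLeastTwo k
  intro i j hij
  have : i / ((k - 1 : ℕ) : ℤ) ≤ j / ((k - 1 : ℕ) : ℤ) :=
    Int.ediv_le_ediv (by omega) hij.le
  simp only [dupSection]; omega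

theorem not_dvd_dupSection (j : ℤ) : ¬ (k : ℤ) ∣ dupSection k j := by
  have hk2 := two_le_of_atLeastTwo k
  have hc : ((k - 1 : ℕ) : ℤ) = k - 1 := by push_cast [Nat.cast_sub (show 1 ≤ k by omega)]; ring
  have h0 := Int.emod_nonneg j (b := (k - 1 : ℕ)) (by omega)
  have h1 := Int.emod_lt_of_pos j (b := (k - 1 : ℕ)) (by omega)
  have h3 := Int.emod_add_mul_ediv j (k - 1 : ℕ)
  rintro ⟨c, hc'⟩
  simp only [dupSection] at hc'
  set q := j / ((k - 1 : ℕ) : ℤ)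
  set r := j % ((k - 1 : ℕ) : ℤ)
  rw [hc] at h3 h1
  have h5 : 1 + r = k * (c - q) := by linarith
  have h6 : (k : ℤ) ∣ 1 + r := ⟨_, h5⟩
  have := Int.le_of_dvd (by omega) h6
  omega

theorem dupIndex_dupSection (j : ℤ) : dupIndex k (dupSection k j) = j := by
  have h := dupSection_dupIndex (k := k) (dupSection k j)
  rw [if_neg (not_dvd_dupSection j)] at h
  exact dupSection_strictMono.injective h

theorem LiftSeq.comp_dupSection_mem {y : ℤ → ℝ} (hy : y ∈ LiftSeq k) (hy0 : y (0 + 1) = y 0) :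
    (fun j => y (dupSection k j)) ∈ StrictSeq (k - 1) := by
  have hyn : ∀ i, ¬ (k : ℤ) ∣ i → y i < y (i + 1) := fun i hi =>
    lt_of_le_of_ne (hy.1 (by omega)) fun h => hi (by simpa using hy.2.2 0 i hy0 h.symm)
  refine ⟨fun i j hij => ?_, fun i => ?_⟩
  · refine lt_of_lt_of_le (hyn _ (not_dvd_dupSection i)) (hy.1 ?_)
    have := dupSection_strictMono (k := k) hij
    omega
  · simp only [dupSection_add_period]; exact hy.2.1 _

theorem mem_strictSeq_of_dup_mem {w : ℤ → ℝ} (h : dup k w ∈ LiftSeq k) :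
    w ∈ StrictSeq (k - 1) := by
  have := LiftSeq.comp_dupSection_mem h
    (congrArg w (dupIndex_succ_of_dvd (k := k) (dvd_zero _)))
  simpa only [dup, dupIndex_dupSection] using this

/-- A sequence in `LiftSeq k` with a coincidence is, up to a shift, a doubled sequence. -/
theorem LiftSeq.strict_or_dup {x : ℤ → ℝ} (hx : x ∈ LiftSeq k) :
    x ∈ StrictSeq k ∨ ∃ n : ℤ, ∃ w ∈ StrictSeq (k - 1), ∀ i, x (i + n) = dup k w i := by
  by_cases h : StrictMono x
  · exact Or.inl ⟨h, hx.2.1⟩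
  right
  obtain ⟨n, hn⟩ : ∃ n, x (n + 1) = x n := by
    by_contra! hne
    exact h (strictMono_int_of_lt_succ fun i =>
      lt_of_le_of_ne (hx.1 (by omega)) (hne i).symm)
  have hy := LiftSeq.shift hx n
  set y : ℤ → ℝ := fun i => x (i + n) with hydef
  have hy0 : y (0 + 1) = y 0 := by
    simp only [hydef]; rw [zero_add, zero_add, add_comm 1 n]; exact hn
  have hyk : ∀ i, (k : ℤ) ∣ i → y (i + 1) = y i := by
    rintro _ ⟨q, rfl⟩
    have h1 := hy.2.1.add_mul 0 q
    have h2 := hy.2.1.add_mul 1 q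
    rw [zero_add] at h1
    rw [add_comm _ 1, h1, h2, ← hy0]; simp
  refine ⟨n, _, LiftSeq.comp_dupSection_mem hy hy0, fun i => ?_⟩
  change y i = y (dupSection k (dupIndex k i))
  rw [dupSection_dupIndex]
  split_ifs with hd
  · exact (hyk i hd).symm
  · rfl

theorem range_comp_dupIndex {X : Type*} (f : ℤ → X) :
    Set.range (fun i => f (dupIndex k i)) = Set.range f :=
  Function.Surjective.range_comp (fun j => ⟨dupSection k j, dupIndex_dupSection j⟩) f

theorem range_dup (w : ℤ → ℝ) : Set.range (dup k w) = Set.range w := range_comp_dupIndex w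

theorem range_comp_shift {X : Type*} (f : ℤ → X) (n : ℤ) :
    Set.range (fun i => f (i + n)) = Set.range f :=
  (Equiv.addRight n).surjective.range_comp f

theorem LiftSeq.ncard_range {x : ℤ → ℝ} (hx : x ∈ LiftSeq k) :
    k - 1 ≤ (Set.range (e ∘ x)).ncard ∧ (Set.range (e ∘ x)).ncard ≤ k := by
  rcases LiftSeq.strict_or_dup hx with h | ⟨n, w, hw, h⟩
  · rw [StrictSeq.ncard_range h]; omega
  · have h2 := range_comp_shift x n
    rw [funext h, range_dup] at h2
    rw [Set.range_comp, ← h2, ← Set.range_comp, StrictSeq.ncard_range hw]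
    omega

/-- A monotone `k`-periodic sequence lying over a set with `m ≥ k - 1` elements belongs to
`LiftSeq k`: it is a strictly increasing sequence precomposed with a map of `ℤ` that advances by
`m` over a period in steps of `0` or `1`, so at most one step per period is stationary. -/
theorem mem_liftSeq_of_ncard {x : ℤ → ℝ} (hm : Monotone x) (hp : IsPeriodic k x)
    (hc : k - 1 ≤ (Set.range (e ∘ x)).ncard) : x ∈ LiftSeq k := by
  have hk2 := two_le_of_atLeastTwo k
  refine ⟨hm, hp, ?_⟩
  have hfin : (Set.range (e ∘ x)).Finite := by
    rw [← hp.range_fin (by omega)]; exact Set.finite_range _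
  obtain ⟨w, hw, hwr⟩ := exists_strictSeq hfin (Set.range_nonempty _)
  set m := (Set.range (e ∘ x)).ncard
  have hr : Set.range x = Set.range w := by
    rw [← hp.preimage_range, ← hw.2.preimage_range, hwr]
  obtain ⟨s, hs, hss, hxs⟩ := exists_reparam hm hw.1 hr
  have hsk : ∀ i, s (i + k) = s i + m := fun i => hw.1.injective (by
    rw [← hxs, hp, hw.2, hxs])
  have hcoin : ∀ i, x (i + 1) = x i → s (i + 1) = s i := fun i hi =>
    hw.1.injective (by rw [← hxs, ← hxs, hi])
  have hskn : ∀ n i : ℤ, s (i + k * n) = s i + m * n := fun n i => hw.1.injective (by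
    rw [← hxs, hp.add_mul, hw.2.add_mul, hxs])
  intro i j hi hj
  by_contra hd
  -- replace `j` by its representative in `i + [0, k)`
  have h0 := Int.emod_nonneg (j - i) (b := k) (by omega)
  have h1 := Int.emod_lt_of_pos (j - i) (b := k) (by omega)
  have h3 := Int.emod_add_mul_ediv (j - i) k
  have hr0 : (j - i) % k ≠ 0 := fun h => hd (Int.dvd_of_emod_eq_zero h)
  set q := (j - i) / (k : ℤ)
  set r := (j - i) % (k : ℤ)
  have hj' : s (i + r + 1) = s (i + r) := by
    have e1 := hcoin j hj
    rw [show j + 1 = i + r + 1 + k * q by linarith, show j = i + r + k * q by linarith,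
      hskn, hskn] at e1
    linarith
  have hi' := hcoin i hi
  have a1 := monotone_surjective_sub_le hs hss (show i + 1 ≤ i + r by omega)
  have a2 := monotone_surjective_sub_le hs hss (show i + r + 1 ≤ i + k by omega)
  have a3 := hsk i
  omega

end

section

/-! ### The space of lifts and its map to the finite subset space -/

variable {k : ℕ}

theorem StratumCompl.ext {S T : StratumCompl k} (h : S.1.carrier = T.1.carrier) : S = T :=
  Subtype.ext (FinSubsetSpace.ext h)

theorem StratumCompl.ncard_bounds (S : StratumCompl k) :
    k - 1 ≤ S.1.carrier.ncard ∧ S.1.carrier.ncard ≤ k := by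
  have h := S.2
  rw [notMem_range_incl] at h
  exact ⟨by omega, S.1.ncard_le⟩

/-- The shift of indices on lifts of `k`-tuples. -/
def shiftLift (x : LiftSeq k) : LiftSeq k := ⟨fun i => x.1 (i + 1), LiftSeq.shift x.2 1⟩

theorem continuous_shiftLift : Continuous (shiftLift (k := k)) :=
  continuous_induced_rng.2 (continuous_pi fun i =>
    (continuous_apply (i + 1)).comp continuous_subtype_val)

theorem iterate_shiftLift_apply (x : LiftSeq k) (n : ℕ) (i : ℤ) :
    (shiftLift^[n] x).1 i = x.1 (i + n) := by
  induction n generalizing i with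
  | zero => simp
  | succ n ih =>
    rw [Function.iterate_succ_apply']
    change (shiftLift^[n] x).1 (i + 1) = _
    rw [ih, add_assoc, add_comm 1]; rfl

/-- The shift of indices on strictly increasing lifts. -/
def shiftStrict {m : ℕ} (w : StrictSeq m) : StrictSeq m :=
  ⟨fun i => w.1 (i + 1), StrictSeq.shift w.2 1⟩

theorem continuous_shiftStrict {m : ℕ} : Continuous (shiftStrict (m := m)) :=
  continuous_induced_rng.2 (continuous_pi fun i =>
    (continuous_apply (i + 1)).comp continuous_subtype_val)

section

variable [hk : k.AtLeastTwo]

/-- The finite subset of the circle below a sequence in `LiftSeq k`. -/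
def subsetOf (x : LiftSeq k) : StratumCompl k :=
  have hk2 := two_le_of_atLeastTwo k
  have h := LiftSeq.ncard_range x.2
  ⟨⟨Set.range (e ∘ x.1), Set.range_nonempty _, Set.finite_of_ncard_pos (by omega), h.2⟩, by
    rw [notMem_range_incl]
    change _ < (Set.range (e ∘ x.1)).ncard
    omega⟩

theorem subsetOf_val (x : LiftSeq k) :
    (subsetOf x).1 = ofTuple fun i : Fin k => e (x.1 (i : ℕ)) :=
  FinSubsetSpace.ext (x.2.2.1.range_fin (pos_of_atLeastTwo k)).symm

theorem continuous_subsetOf : Continuous (subsetOf (k := k)) := by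
  refine Continuous.subtype_mk (f := fun x => (subsetOf x).1) ?_ (fun x => (subsetOf x).2)
  simp only [subsetOf_val]
  refine continuous_ofTuple.comp (continuous_pi fun i => continuous_e.comp ?_)
  exact (continuous_apply _).comp continuous_subtype_val

/-- The inclusion of the lifts of `(k - 1)`-tuples as a face of the space of lifts. -/
def dupLift (w : StrictSeq (k - 1)) : LiftSeq k := ⟨dup k w.1, dup_mem w.2⟩

theorem continuous_dupLift : Continuous (dupLift (k := k)) :=
  continuous_induced_rng.2 (continuous_pi fun i =>
    (continuous_apply (dupIndex k i)).comp continuous_subtype_val)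

theorem subsetOf_shiftLift (x : LiftSeq k) : subsetOf (shiftLift x) = subsetOf x :=
  StratumCompl.ext (range_comp_shift (e ∘ x.1) 1)

theorem carrier_subsetOf_dupLift (w : StrictSeq (k - 1)) :
    (subsetOf (dupLift w)).1.carrier = Set.range (e ∘ w.1) := by
  change Set.range (e ∘ dup k w.1) = _
  rw [Set.range_comp, range_dup, ← Set.range_comp]

theorem subsetOf_dupLift_shiftStrict (w : StrictSeq (k - 1)) :
    subsetOf (dupLift (shiftStrict w)) = subsetOf (dupLift w) :=
  StratumCompl.ext (by
    rw [carrier_subsetOf_dupLift, carrier_subsetOf_dupLift]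
    exact range_comp_shift (e ∘ w.1) 1)

theorem surjective_subsetOf : Function.Surjective (subsetOf (k := k)) := by
  intro S
  obtain ⟨w, hw, hwr⟩ := exists_strictSeq S.1.finite S.1.nonempty
  have hc := S.ncard_bounds
  rcases (show S.1.carrier.ncard = k ∨ S.1.carrier.ncard = k - 1 by omega) with h | h
  · rw [h] at hw
    exact ⟨⟨w, StrictSeq.mem_liftSeq hw⟩, StratumCompl.ext hwr⟩
  · rw [h] at hw
    exact ⟨dupLift ⟨w, hw⟩, StratumCompl.ext (by rw [carrier_subsetOf_dupLift]; exact hwr)⟩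

/-- The fibres of `subsetOf` are generated by the two shifts: the one on `k`-tuples and, on
the face of doubled sequences, the one on `(k - 1)`-tuples. -/
theorem fiber_induction {P : LiftSeq k → LiftSeq k → Prop} (hP : Equivalence P)
    (hshift : ∀ x, P x (shiftLift x)) (hdup : ∀ w, P (dupLift w) (dupLift (shiftStrict w)))
    {x y : LiftSeq k} (h : subsetOf x = subsetOf y) : P x y := by
  have hk2 := two_le_of_atLeastTwo k
  have shiftN : ∀ (n : ℤ) (x y : LiftSeq k), (∀ i, y.1 i = x.1 (i + n)) → P x y := by
    intro n
    induction n with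
    | zero =>
      intro x y hxy
      rw [show y = x from Subtype.ext (funext fun i => by rw [hxy]; simp)]
      exact hP.refl x
    | succ n ih =>
      intro x y hxy
      refine hP.trans (hshift x) (ih (shiftLift x) y fun i => ?_)
      rw [hxy, ← add_assoc]; rfl
    | pred n ih =>
      intro x y hxy
      refine hP.trans (ih x (shiftLift y) fun i => ?_) (hP.symm (hshift y))
      rw [shiftLift, hxy, add_assoc, add_sub_cancel]
  have dupN : ∀ (n : ℤ) (v w : StrictSeq (k - 1)), (∀ i, w.1 i = v.1 (i + n)) →
      P (dupLift v) (dupLift w) := by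
    intro n
    induction n with
    | zero =>
      intro x y hxy
      rw [show y = x from Subtype.ext (funext fun i => by rw [hxy]; simp)]
      exact hP.refl _
    | succ n ih =>
      intro x y hxy
      refine hP.trans (hdup x) (ih (shiftStrict x) y fun i => ?_)
      rw [hxy, ← add_assoc]; rfl
    | pred n ih =>
      intro x y hxy
      refine hP.trans (ih x (shiftStrict y) fun i => ?_) (hP.symm (hdup y))
      rw [shiftStrict, hxy, add_assoc, add_sub_cancel]
  have hc : Set.range (e ∘ x.1) = Set.range (e ∘ y.1) := congrArg (fun S => S.1.carrier) h
  have hr : Set.range x.1 = Set.range y.1 := by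
    rw [← x.2.2.1.preimage_range, ← y.2.2.1.preimage_range, hc]
  have cardDup : ∀ (z : LiftSeq k) (n : ℤ) (w : ℤ → ℝ), w ∈ StrictSeq (k - 1) →
      (∀ i, z.1 (i + n) = dup k w i) → Set.range z.1 = Set.range w ∧
        (Set.range (e ∘ z.1)).ncard = k - 1 := by
    intro z n w hw hz
    have h2 := range_comp_shift z.1 n
    rw [funext hz, range_dup] at h2
    rw [Set.range_comp, ← h2, ← Set.range_comp, StrictSeq.ncard_range hw]
    exact ⟨rfl, rfl⟩
  rcases LiftSeq.strict_or_dup x.2 with hx | ⟨n, v, hv, hxn⟩ <;>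
    rcases LiftSeq.strict_or_dup y.2 with hy | ⟨p, w, hw, hyp⟩
  · obtain ⟨n, hn⟩ := exists_shift_of_range_eq hy.1 hx.1 hr.symm
    exact shiftN n x y hn
  · have := (cardDup y p w hw hyp).2
    rw [← hc, StrictSeq.ncard_range hx] at this
    omega
  · have := (cardDup x n v hv hxn).2
    rw [hc, StrictSeq.ncard_range hy] at this
    omega
  · have hvw : Set.range w = Set.range v := by
      rw [← (cardDup y p w hw hyp).1, ← (cardDup x n v hv hxn).1, hr]
    obtain ⟨q, hq⟩ := exists_shift_of_range_eq hw.1 hv.1 hvw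
    have h1 : P x (dupLift ⟨v, hv⟩) := shiftN n _ _ fun i => (hxn i).symm
    have h2 : P y (dupLift ⟨w, hw⟩) := shiftN p _ _ fun i => (hyp i).symm
    exact hP.trans h1 (hP.trans (dupN q ⟨v, hv⟩ ⟨w, hw⟩ hq) (hP.symm h2))

end

/-! ### Small neighbourhoods and the collapse onto their centre -/

/-- The open arc of radius `ε` about a point of the circle, as the image of an interval. -/
def arc (p : Circle) (ε : ℝ) : Set Circle := e '' {x | ∃ l, e l = p ∧ |x - l| < ε}

theorem mem_arc {x : ℝ} {p : Circle} {ε : ℝ} : e x ∈ arc p ε ↔ ∃ l, e l = p ∧ |x - l| < ε := by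
  constructor
  · rintro ⟨y, ⟨l, hl, hyl⟩, hy⟩
    obtain ⟨n, hn⟩ := e_eq_iff.1 hy
    refine ⟨l - n, ?_, ?_⟩
    · rw [← hl, e_eq_iff]; exact ⟨-n, by push_cast; ring⟩
    · rwa [show x - (l - n) = y - l by rw [hn]; ring]
  · intro h; exact ⟨x, h, rfl⟩

theorem isOpen_arc (p : Circle) (ε : ℝ) : IsOpen (arc p ε) := by
  refine isOpenMap_e _ ?_
  rw [show {x : ℝ | ∃ l, e l = p ∧ |x - l| < ε} = ⋃ l ∈ e ⁻¹' {p}, {x | |x - l| < ε} by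
    ext; simp]
  exact isOpen_biUnion fun l _ => isOpen_lt (by fun_prop) continuous_const

/-- The finite subsets contained in the union of the `ε`-arcs about the points of `S₀` and
meeting each of these arcs. -/
def nbhd (S₀ : StratumCompl k) (ε : ℝ) : Set (FinSubsetSpace k Circle) :=
  {S | (∀ z ∈ S.carrier, ∃ p ∈ S₀.1.carrier, z ∈ arc p ε) ∧
    ∀ p ∈ S₀.1.carrier, ∃ z ∈ S.carrier, z ∈ arc p ε}

theorem isOpen_nbhd [k.AtLeastTwo] (S₀ : StratumCompl k) (ε : ℝ) : IsOpen (nbhd S₀ ε) := by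
  refine isOpen_coinduced.2 ?_
  have : ofTuple ⁻¹' nbhd S₀ ε =
      (⋂ i : Fin k, (fun x : Fin k → Circle => x i) ⁻¹' ⋃ p ∈ S₀.1.carrier, arc p ε) ∩
        ⋂ p ∈ S₀.1.carrier, ⋃ i : Fin k, (fun x : Fin k → Circle => x i) ⁻¹' arc p ε := by
    ext x
    simp [nbhd, ofTuple]
  rw [this]
  refine IsOpen.inter (isOpen_iInter_of_finite fun i => ?_) (S₀.1.finite.isOpen_biInter fun p _ =>
    isOpen_iUnion fun i => (isOpen_arc p ε).preimage (continuous_apply i))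
  exact (isOpen_biUnion fun p _ => isOpen_arc p ε).preimage (continuous_apply i)

theorem self_mem_nbhd (S₀ : StratumCompl k) {ε : ℝ} (hε : 0 < ε) : S₀.1 ∈ nbhd S₀ ε := by
  have : ∀ p, p ∈ arc p ε := fun p => by
    obtain ⟨x, rfl⟩ := e_surjective p
    exact mem_arc.2 ⟨x, rfl, by simpa using hε⟩
  exact ⟨fun z hz => ⟨z, hz, this z⟩, fun z hz => ⟨z, hz, this z⟩⟩

theorem nbhd_mono (S₀ : StratumCompl k) {ε δ : ℝ} (h : ε ≤ δ) : nbhd S₀ ε ⊆ nbhd S₀ δ := by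
  have : ∀ p, arc p ε ⊆ arc p δ := fun p =>
    Set.image_mono fun x ⟨l, hl, hx⟩ => ⟨l, hl, hx.trans_le h⟩
  exact fun S hS => ⟨fun z hz => (hS.1 z hz).imp fun p hp => ⟨hp.1, this p hp.2⟩,
    fun p hp => (hS.2 p hp).imp fun z hz => ⟨hz.1, this p hz.2⟩⟩

/-- The preimage in `ℝ` of a finite subset of the circle is uniformly discrete. -/
theorem exists_separated (S₀ : StratumCompl k) :
    ∃ ε > 0, ∀ l l', e l ∈ S₀.1.carrier → e l' ∈ S₀.1.carrier → |l - l'| < 4 * ε → l = l' := by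
  obtain ⟨w, hw, hwr⟩ := exists_strictSeq S₀.1.finite S₀.1.nonempty
  have hm := StrictSeq.pos hw
  generalize S₀.1.carrier.ncard = m at hw hm
  have : Nonempty (Fin m) := ⟨⟨0, hm⟩⟩
  obtain ⟨i₀, hi₀⟩ := Finite.exists_min fun i : Fin m => w ((i : ℕ) + 1) - w (i : ℕ)
  have hgap : ∀ i : ℤ, w ((i₀ : ℕ) + 1) - w (i₀ : ℕ) ≤ w (i + 1) - w i := by
    intro i
    have h0 := Int.emod_nonneg i (b := m) (by omega)
    have h1 := Int.emod_lt_of_pos i (b := m) (by omega)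
    have := hi₀ ⟨(i % m).toNat, by omega⟩
    simp only [Int.toNat_of_nonneg h0] at this
    have e1 := hw.2.add_mul (i % m) (i / m)
    have e2 := hw.2.add_mul (i % m + 1) (i / m)
    rw [show i % m + 1 + m * (i / m) = i + 1 by
      linarith [Int.emod_add_mul_ediv i m]] at e2
    rw [Int.emod_add_mul_ediv] at e1
    linarith
  have hpos : 0 < w ((i₀ : ℕ) + 1) - w (i₀ : ℕ) := sub_pos.2 (hw.1 (by omega))
  have hlt : ∀ i j : ℤ, i < j → w ((i₀ : ℕ) + 1) - w (i₀ : ℕ) ≤ w j - w i := fun i j hij =>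
    (hgap i).trans (sub_le_sub_right (hw.1.monotone (by omega)) _)
  refine ⟨(w ((i₀ : ℕ) + 1) - w (i₀ : ℕ)) / 4, by linarith, fun l l' hl hl' hll => ?_⟩
  have hmem : ∀ l, e l ∈ S₀.1.carrier → l ∈ Set.range w := fun l hl => by
    rw [← hw.2.preimage_range, hwr]; exact hl
  obtain ⟨i, rfl⟩ := hmem l hl
  obtain ⟨j, rfl⟩ := hmem l' hl'
  rw [abs_lt] at hll
  rcases lt_trichotomy i j with hij | rfl | hij
  · have := hlt i j hij; linarith
  · rfl
  · have := hlt j i hij; linarith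

/-- A radius at which the arcs about the points of `S₀` are well separated. -/
def sepRadius (S₀ : StratumCompl k) : ℝ := (exists_separated S₀).choose

theorem sepRadius_pos (S₀ : StratumCompl k) : 0 < sepRadius S₀ :=
  (exists_separated S₀).choose_spec.1

theorem eq_of_abs_sub_lt {S₀ : StratumCompl k} {l l' : ℝ} (hl : e l ∈ S₀.1.carrier)
    (hl' : e l' ∈ S₀.1.carrier) (h : |l - l'| < 4 * sepRadius S₀) : l = l' :=
  (exists_separated S₀).choose_spec.2 l l' hl hl' h

/-- The point over `S₀` within distance `sepRadius S₀` of `x` (a junk value if there is none). -/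
def near (S₀ : StratumCompl k) (x : ℝ) : ℝ :=
  Classical.epsilon fun l => e l ∈ S₀.1.carrier ∧ |x - l| < sepRadius S₀

theorem near_eq {S₀ : StratumCompl k} {x l : ℝ} (hl : e l ∈ S₀.1.carrier)
    (h : |x - l| < sepRadius S₀) : near S₀ x = l := by
  have hs : e (near S₀ x) ∈ S₀.1.carrier ∧ |x - near S₀ x| < sepRadius S₀ :=
    Classical.epsilon_spec (p := fun l => e l ∈ S₀.1.carrier ∧ |x - l| < sepRadius S₀) ⟨l, hl, h⟩
  refine eq_of_abs_sub_lt hs.1 hl ?_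
  have := sepRadius_pos S₀
  have h2 := hs.2
  rw [abs_lt] at h h2 ⊢
  constructor <;> linarith

theorem near_self {S₀ : StratumCompl k} {x : ℝ} (hx : e x ∈ S₀.1.carrier) : near S₀ x = x :=
  near_eq hx (by simpa using sepRadius_pos S₀)

theorem near_spec {S₀ : StratumCompl k} {ε : ℝ} {S : FinSubsetSpace k Circle}
    (hε : ε ≤ sepRadius S₀) (hS : S ∈ nbhd S₀ ε) {x : ℝ} (hx : e x ∈ S.carrier) :
    e (near S₀ x) ∈ S₀.1.carrier ∧ |x - near S₀ x| < ε := by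
  obtain ⟨p, hp, hxp⟩ := hS.1 _ hx
  obtain ⟨l, rfl, hl⟩ := mem_arc.1 hxp
  rw [near_eq hp (hl.trans_le hε)]
  exact ⟨hp, hl⟩

theorem near_add_int {S₀ : StratumCompl k} {S : FinSubsetSpace k Circle}
    (hS : S ∈ nbhd S₀ (sepRadius S₀)) {x : ℝ} (hx : e x ∈ S.carrier) (n : ℤ) :
    near S₀ (x + n) = near S₀ x + n := by
  have h := near_spec le_rfl hS hx
  refine near_eq (by rw [e_add_int]; exact h.1) ?_
  rw [add_sub_add_right_eq_sub]; exact h.2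

theorem near_mono {S₀ : StratumCompl k} {S : FinSubsetSpace k Circle}
    (hS : S ∈ nbhd S₀ (sepRadius S₀)) {x y : ℝ} (hx : e x ∈ S.carrier) (hy : e y ∈ S.carrier)
    (hxy : x ≤ y) : near S₀ x ≤ near S₀ y := by
  have h1 := near_spec le_rfl hS hx
  have h2 := near_spec le_rfl hS hy
  have hp := sepRadius_pos S₀
  by_contra! hlt
  refine hlt.ne' (eq_of_abs_sub_lt h1.1 h2.1 ?_)
  have a1 := abs_lt.1 h1.2
  have a2 := abs_lt.1 h2.2
  rw [abs_lt]; constructor <;> linarith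

theorem eventually_near_eq {S₀ : StratumCompl k} {S : FinSubsetSpace k Circle}
    (hS : S ∈ nbhd S₀ (sepRadius S₀)) {x : ℝ} (hx : e x ∈ S.carrier) :
    ∀ᶠ y in 𝓝 x, near S₀ y = near S₀ x := by
  have h := near_spec le_rfl hS hx
  have ho : IsOpen {y : ℝ | |y - near S₀ x| < sepRadius S₀} :=
    isOpen_lt (by fun_prop) continuous_const
  filter_upwards [ho.mem_nhds h.2] with y hy using near_eq h.1 hy

section

variable [hk : k.AtLeastTwo]

theorem e_mem_subsetOf (x : LiftSeq k) (i : ℤ) : e (x.1 i) ∈ (subsetOf x).1.carrier := ⟨i, rfl⟩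

theorem range_near {S₀ : StratumCompl k} {x : LiftSeq k}
    (hx : (subsetOf x).1 ∈ nbhd S₀ (sepRadius S₀)) :
    Set.range (e ∘ fun i => near S₀ (x.1 i)) = S₀.1.carrier := by
  ext p
  constructor
  · rintro ⟨i, rfl⟩
    exact (near_spec le_rfl hx (e_mem_subsetOf x i)).1
  · intro hp
    obtain ⟨_, ⟨i, rfl⟩, hz⟩ := hx.2 p hp
    obtain ⟨l, rfl, hl⟩ := mem_arc.1 hz
    exact ⟨i, by simp only [Function.comp_apply]; rw [near_eq hp hl]⟩

/-- Replacing each entry of a lift by the nearest point over `S₀` gives a lift of `S₀`. -/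
theorem near_mem_liftSeq {S₀ : StratumCompl k} {x : LiftSeq k}
    (hx : (subsetOf x).1 ∈ nbhd S₀ (sepRadius S₀)) : (fun i => near S₀ (x.1 i)) ∈ LiftSeq k := by
  refine mem_liftSeq_of_ncard
    (fun i j hij => near_mono hx (e_mem_subsetOf x i) (e_mem_subsetOf x j) (x.2.1 hij))
    (fun i => ?_) (by rw [range_near hx]; exact S₀.ncard_bounds.1)
  rw [x.2.2.1 i]
  exact_mod_cast near_add_int hx (e_mem_subsetOf x i) 1

/-- The lift of `S₀` near a lift `x` of a set in a small neighbourhood of `S₀`. -/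
def collapse (S₀ : StratumCompl k) (x : LiftSeq k)
    (hx : (subsetOf x).1 ∈ nbhd S₀ (sepRadius S₀)) : LiftSeq k :=
  ⟨fun i => near S₀ (x.1 i), near_mem_liftSeq hx⟩

theorem subsetOf_collapse {S₀ : StratumCompl k} {x : LiftSeq k}
    (hx : (subsetOf x).1 ∈ nbhd S₀ (sepRadius S₀)) : subsetOf (collapse S₀ x hx) = S₀ :=
  StratumCompl.ext (range_near hx)

end

end

section

variable {k : ℕ}

/-! ### Straight paths of lifts -/

/-- The point at time `t` of the straight path from `x` to `y` in the convex space of lifts. -/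
def segLift (x y : LiftSeq k) (t : I) : LiftSeq k :=
  ⟨(1 - (t : ℝ)) • x.1 + (t : ℝ) • y.1,
    convex_liftSeq k x.2 y.2 (sub_nonneg.2 t.2.2) t.2.1 (by ring)⟩

theorem segLift_apply (x y : LiftSeq k) (t : I) (i : ℤ) :
    (segLift x y t).1 i = (1 - (t : ℝ)) * x.1 i + t * y.1 i := rfl

/-- The straight path from `x` to `y` in the space of lifts. -/
def segPath (x y : LiftSeq k) : Path x y where
  toFun := segLift x y
  continuous_toFun := continuous_induced_rng.2 (continuous_pi fun i => by
    change Continuous fun t : I => (1 - (t : ℝ)) * x.1 i + t * y.1 i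
    fun_prop)
  source' := Subtype.ext (funext fun i => by simp [segLift_apply])
  target' := Subtype.ext (funext fun i => by simp [segLift_apply])

section

variable [hk : k.AtLeastTwo]

/-- The evenly spaced sequence `i ↦ i / m`, lifting the `m`-th roots of unity. -/
def evenStrict (m : ℕ) (hm : 0 < m) : StrictSeq m :=
  ⟨fun i => (i : ℝ) / m, fun i j hij => by
    have : (0 : ℝ) < m := by exact_mod_cast hm
    have : (i : ℝ) < j := by exact_mod_cast hij
    simp only
    gcongr, fun i => by
    have : (m : ℝ) ≠ 0 := by exact_mod_cast hm.ne'
    push_cast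
    field_simp⟩

/-- The evenly spaced lift of the `k`-th roots of unity. -/
def evenLift (k : ℕ) [hk : k.AtLeastTwo] : LiftSeq k :=
  ⟨_, StrictSeq.mem_liftSeq
    (evenStrict k (pos_of_atLeastTwo k)).2⟩

instance : SimplyConnectedSpace (LiftSeq k) :=
  have := (convex_liftSeq k).contractibleSpace ⟨_, (evenLift k).2⟩
  inferInstance

theorem strictSeq_pathConnected {m : ℕ} (v w : StrictSeq m) : Nonempty (Path v w) := by
  have := (convex_strictSeq m).contractibleSpace ⟨_, v.2⟩
  exact ⟨PathConnectedSpace.somePath v w⟩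

/-- The homotopy class of the image of a path from `x` to `y` in the simply connected space of
lifts, with flexible endpoints. -/
def liftClass (x y : LiftSeq k) {S T : StratumCompl k} (hS : subsetOf x = S)
    (hT : subsetOf y = T) : Path.Homotopic.Quotient S T :=
  (Path.Homotopic.Quotient.mk ((segPath x y).map continuous_subsetOf)).cast hS.symm hT.symm

theorem mk_eq_liftClass {x y : LiftSeq k} {S T : StratumCompl k} (hS : subsetOf x = S)
    (hT : subsetOf y = T) (r : Path x y) (p : Path S T) (h : ∀ t, p t = subsetOf (r t)) :
    Path.Homotopic.Quotient.mk p = liftClass x y hS hT := by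
  subst hS hT
  have hp : p = r.map continuous_subsetOf := Path.ext (funext h)
  rw [hp, liftClass, Path.Homotopic.Quotient.cast_rfl_rfl, Path.Homotopic.Quotient.eq]
  exact (SimplyConnectedSpace.paths_homotopic r (segPath x y)).map ⟨_, continuous_subsetOf⟩

theorem liftClass_trans (x y z : LiftSeq k) {S T U : StratumCompl k} (hS : subsetOf x = S)
    (hT : subsetOf y = T) (hU : subsetOf z = U) :
    (liftClass x y hS hT).trans (liftClass y z hT hU) = liftClass x z hS hU := by
  subst hS hT hU
  rw [← mk_eq_liftClass rfl rfl ((segPath x y).trans (segPath y z))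
    (((segPath x y).map continuous_subsetOf).trans ((segPath y z).map continuous_subsetOf))
    fun t => by rw [← Path.map_trans]; rfl]
  rfl

theorem liftClass_self (x : LiftSeq k) {S : StratumCompl k} (hS : subsetOf x = S) :
    liftClass x x hS hS = Path.Homotopic.Quotient.refl S := by
  subst hS
  rw [← mk_eq_liftClass rfl rfl (Path.refl x) (Path.refl _) fun _ => rfl]
  rfl

theorem liftClass_symm (x y : LiftSeq k) {S T : StratumCompl k} (hS : subsetOf x = S)
    (hT : subsetOf y = T) : (liftClass x y hS hT).symm = liftClass y x hT hS := by
  subst hS hT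
  rw [← mk_eq_liftClass rfl rfl (segPath x y).symm
    ((segPath x y).map continuous_subsetOf).symm fun t => rfl]
  rfl

theorem liftClass_shift (x y : LiftSeq k) {S T : StratumCompl k} (hS : subsetOf x = S)
    (hT : subsetOf y = T) (hS' : subsetOf (shiftLift x) = S) (hT' : subsetOf (shiftLift y) = T) :
    liftClass (shiftLift x) (shiftLift y) hS' hT' = liftClass x y hS hT := by
  subst hS hT
  rw [← mk_eq_liftClass rfl rfl (segPath x y) ((segPath x y).map continuous_subsetOf)
    fun _ => rfl]
  exact (mk_eq_liftClass _ _ ((segPath x y).map continuous_shiftLift) _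
    fun t => (subsetOf_shiftLift _).symm).symm

theorem liftClass_shiftStrict (v w : StrictSeq (k - 1)) {S T : StratumCompl k}
    (hS : subsetOf (dupLift v) = S) (hT : subsetOf (dupLift w) = T)
    (hS' : subsetOf (dupLift (shiftStrict v)) = S)
    (hT' : subsetOf (dupLift (shiftStrict w)) = T) :
    liftClass (dupLift (shiftStrict v)) (dupLift (shiftStrict w)) hS' hT' =
      liftClass (dupLift v) (dupLift w) hS hT := by
  subst hS hT
  obtain ⟨r⟩ := strictSeq_pathConnected v w
  have h1 := mk_eq_liftClass rfl rfl (r.map continuous_dupLift)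
    ((r.map continuous_dupLift).map continuous_subsetOf) fun _ => rfl
  have h2 := mk_eq_liftClass hS' hT' ((r.map continuous_shiftStrict).map continuous_dupLift)
    ((r.map continuous_dupLift).map continuous_subsetOf)
    fun t => (subsetOf_dupLift_shiftStrict _).symm
  rw [← h1, ← h2]

/-! ### Loops given by changing the lift -/

/-- The loop that runs from the basepoint `subsetOf z` along the image of the segment from `z` to
`x`, changes to the lift `y` of the same set, and returns along the image of the segment from `y`
to `z`. In `FundamentalGroup` the product `p * q` means `q` followed by `p`. -/
def jump (z x y : LiftSeq k) (h : subsetOf x = subsetOf y) :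
    FundamentalGroup (StratumCompl k) (subsetOf z) :=
  (liftClass z x rfl rfl).trans (liftClass y z h.symm rfl)

theorem trans_eq_jump (z x y : LiftSeq k) {S : StratumCompl k} (hx : subsetOf x = S)
    (hy : subsetOf y = S) :
    (liftClass z x rfl hx).trans (liftClass y z hy rfl) = jump z x y (hx.trans hy.symm) := by
  subst hx; rfl

theorem trans_cancel {X : Type*} [TopologicalSpace X] {a b c d : X}
    (p : Path.Homotopic.Quotient a b) (q : Path.Homotopic.Quotient b c)
    (q' : Path.Homotopic.Quotient c b) (r : Path.Homotopic.Quotient b d)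
    (h : q.trans q' = Path.Homotopic.Quotient.refl b) :
    (p.trans q).trans (q'.trans r) = p.trans r := by
  rw [Path.Homotopic.Quotient.trans_assoc, ← Path.Homotopic.Quotient.trans_assoc q, h,
    Path.Homotopic.Quotient.refl_trans]

theorem jump_mul (z x y w : LiftSeq k) (h : subsetOf x = subsetOf y)
    (h' : subsetOf y = subsetOf w) : jump z y w h' * jump z x y h = jump z x w (h.trans h') := by
  rw [FundamentalGroup.mul_def, ← trans_eq_jump z y w h.symm (h'.symm.trans h.symm)]
  refine trans_cancel _ _ _ _ ?_
  rw [liftClass_trans, liftClass_self]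

theorem jump_self (z x : LiftSeq k) : jump z x x rfl = 1 := by
  rw [jump, liftClass_trans, liftClass_self]; rfl

theorem jump_inv (z x y : LiftSeq k) (h : subsetOf x = subsetOf y) :
    (jump z x y h)⁻¹ = jump z y x h.symm :=
  inv_eq_of_mul_eq_one_left (by rw [jump_mul, jump_self])

/-- Shifting the lift of a `k`-tuple gives the same loop for all lifts. -/
theorem jump_shiftLift (z x y : LiftSeq k) :
    jump z (shiftLift x) x (subsetOf_shiftLift x) =
      jump z (shiftLift y) y (subsetOf_shiftLift y) := by
  rw [jump, jump, ← liftClass_trans z (shiftLift y) (shiftLift x) rfl (subsetOf_shiftLift y) rfl,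
    ← liftClass_trans x y z (subsetOf_shiftLift x).symm rfl rfl,
    liftClass_shift y x rfl (subsetOf_shiftLift x).symm (subsetOf_shiftLift y) rfl,
    trans_cancel _ _ _ _ (by
      rw [liftClass_trans, liftClass_self])]
  exact trans_eq_jump z _ _ _ _

/-- Shifting the lift of a `(k - 1)`-tuple gives the same loop for all lifts. -/
theorem jump_dupLift (z : LiftSeq k) (v w : StrictSeq (k - 1)) :
    jump z (dupLift (shiftStrict v)) (dupLift v) (subsetOf_dupLift_shiftStrict v) =
      jump z (dupLift (shiftStrict w)) (dupLift w) (subsetOf_dupLift_shiftStrict w) := by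
  have hv := subsetOf_dupLift_shiftStrict v
  have hw := subsetOf_dupLift_shiftStrict w
  rw [jump, jump, ← liftClass_trans z (dupLift (shiftStrict w)) (dupLift (shiftStrict v)) rfl hw rfl,
    ← liftClass_trans (dupLift v) (dupLift w) z hv.symm rfl rfl,
    trans_cancel _ _ _ _ (by
      rw [liftClass_shiftStrict w v rfl hv.symm hw rfl, liftClass_trans, liftClass_self])]
  exact trans_eq_jump z _ _ _ _

/-- The class of the loop `α`, based at an arbitrary lift. -/
def rotClass (z : LiftSeq k) : FundamentalGroup (StratumCompl k) (subsetOf z) :=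
  jump z (shiftLift z) z (subsetOf_shiftLift z)

/-- The class of the loop `β`, based at an arbitrary lift, defined using the lift `w` of a
`(k - 1)`-tuple. -/
def faceRotClass (z : LiftSeq k) (w : StrictSeq (k - 1)) :
    FundamentalGroup (StratumCompl k) (subsetOf z) :=
  jump z (dupLift (shiftStrict w)) (dupLift w) (subsetOf_dupLift_shiftStrict w)

theorem subsetOf_iterate_shiftLift (x : LiftSeq k) (n : ℕ) :
    subsetOf (shiftLift^[n] x) = subsetOf x := by
  induction n with
  | zero => rfl
  | succ n ih => rw [Function.iterate_succ_apply', subsetOf_shiftLift, ih]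

theorem subsetOf_dupLift_iterate_shiftStrict (w : StrictSeq (k - 1)) (n : ℕ) :
    subsetOf (dupLift (shiftStrict^[n] w)) = subsetOf (dupLift w) := by
  induction n with
  | zero => rfl
  | succ n ih => rw [Function.iterate_succ_apply', subsetOf_dupLift_shiftStrict, ih]

theorem rotClass_pow (z x : LiftSeq k) (n : ℕ) :
    rotClass z ^ n = jump z (shiftLift^[n] x) x (subsetOf_iterate_shiftLift x n) := by
  induction n with
  | zero => exact (jump_self z x).symm
  | succ n ih =>
    rw [pow_succ, ih, rotClass, jump_shiftLift z z (shiftLift^[n] x), jump_mul]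
    congr 1
    exact (Function.iterate_succ_apply' _ _ _).symm

theorem faceRotClass_pow (z : LiftSeq k) (w : StrictSeq (k - 1)) (n : ℕ) :
    faceRotClass z w ^ n = jump z (dupLift (shiftStrict^[n] w)) (dupLift w)
      (subsetOf_dupLift_iterate_shiftStrict w n) := by
  induction n with
  | zero => exact (jump_self z _).symm
  | succ n ih =>
    rw [pow_succ, ih, faceRotClass, jump_dupLift z w (shiftStrict^[n] w), jump_mul]
    congr 2
    exact (Function.iterate_succ_apply' _ _ _).symm

theorem iterate_shiftStrict_apply {m : ℕ} (w : StrictSeq m) (n : ℕ) (i : ℤ) :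
    (shiftStrict^[n] w).1 i = w.1 (i + n) := by
  induction n generalizing i with
  | zero => simp
  | succ n ih =>
    rw [Function.iterate_succ_apply']
    change (shiftStrict^[n] w).1 (i + 1) = _
    rw [ih, add_assoc, add_comm 1]; rfl

/-- The relation `α ^ k = β ^ (k - 1)`: both sides translate a doubled sequence by one full
turn. -/
theorem rotClass_pow_eq (z : LiftSeq k) (w : StrictSeq (k - 1)) :
    rotClass z ^ k = faceRotClass z w ^ (k - 1) := by
  rw [rotClass_pow z (dupLift w), faceRotClass_pow]
  congr 1
  refine Subtype.ext (funext fun i => ?_)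
  rw [iterate_shiftLift_apply, (dupLift w).2.2.1]
  change _ = (shiftStrict^[k - 1] w).1 (dupIndex k i)
  rw [iterate_shiftStrict_apply, w.2.2]
  rfl

/-- A change of lift over any point gives a loop in the subgroup generated by `α` and `β`. -/
theorem jump_mem (z : LiftSeq k) (w : StrictSeq (k - 1)) {x y : LiftSeq k}
    (h : subsetOf x = subsetOf y) :
    jump z x y h ∈ Subgroup.closure {rotClass z, faceRotClass z w} := by
  set H := Subgroup.closure {rotClass z, faceRotClass z w} with hH
  have key : ∃ h : subsetOf x = subsetOf y, jump z x y h ∈ H := by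
    refine fiber_induction (P := fun x y => ∃ h : subsetOf x = subsetOf y, jump z x y h ∈ H)
      ⟨fun x => ⟨rfl, ?_⟩, ?_, ?_⟩ (fun x => ⟨(subsetOf_shiftLift x).symm, ?_⟩)
      (fun v => ⟨(subsetOf_dupLift_shiftStrict v).symm, ?_⟩) h
    · rw [jump_self]; exact H.one_mem
    · rintro x y ⟨h, hm⟩
      exact ⟨h.symm, by rw [← jump_inv z x y h]; exact H.inv_mem hm⟩
    · rintro x y u ⟨h, hm⟩ ⟨h', hm'⟩
      exact ⟨h.trans h', by rw [← jump_mul z x y u h h']; exact H.mul_mem hm' hm⟩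
    · rw [← jump_inv z _ _ (subsetOf_shiftLift x), jump_shiftLift z x z]
      exact H.inv_mem (Subgroup.subset_closure (Or.inl rfl))
    · rw [← jump_inv z _ _ (subsetOf_dupLift_shiftStrict v), jump_dupLift z v w]
      exact H.inv_mem (Subgroup.subset_closure (Or.inr rfl))
  exact key.2

/-! ### The collapse homotopy -/

/-- The image on the circle of `S` at time `t` when each point of the preimage of `S` moves
linearly to the nearest point over `S₀`. -/
def collapseSet (S₀ : StratumCompl k) (S : Set Circle) (t : I) : Set Circle :=
  (fun x => e ((1 - (t : ℝ)) * x + t * near S₀ x)) '' (e ⁻¹' S)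

theorem carrier_segLift_collapse {S₀ : StratumCompl k} {x : LiftSeq k}
    (hx : (subsetOf x).1 ∈ nbhd S₀ (sepRadius S₀)) (t : I) :
    (subsetOf (segLift x (collapse S₀ x hx) t)).1.carrier =
      collapseSet S₀ (subsetOf x).1.carrier t := by
  rw [collapseSet, show (subsetOf x).1.carrier = Set.range (e ∘ x.1) from rfl,
    x.2.2.1.preimage_range, ← Set.range_comp]
  rfl

theorem range_collapse {S₀ : StratumCompl k} {v : Fin k → ℝ}
    (hv : ofTuple (fun i => e (v i)) ∈ nbhd S₀ (sepRadius S₀)) (t : I) :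
    (Set.range fun i => e ((1 - (t : ℝ)) * v i + t * near S₀ (v i))) =
      collapseSet S₀ (ofTuple fun i => e (v i)).carrier t := by
  ext z
  constructor
  · rintro ⟨i, rfl⟩
    exact ⟨v i, ⟨i, rfl⟩, rfl⟩
  · rintro ⟨x, ⟨i, hi⟩, rfl⟩
    obtain ⟨n, rfl⟩ := e_eq_iff.1 hi.symm
    refine ⟨i, ?_⟩
    simp only
    rw [near_add_int hv ⟨i, rfl⟩, e_eq_iff]
    exact ⟨-n, by push_cast; ring⟩

/-- A small neighbourhood of `S₀` in `exp_k(S¹)` contains no sets with fewer points than `S₀`,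
so it lies in the complement of `exp_{k-2}(S¹)`. -/
theorem exists_lift_of_mem_nbhd {S₀ : StratumCompl k} {S : FinSubsetSpace k Circle}
    (hS : S ∈ nbhd S₀ (sepRadius S₀)) : ∃ x : LiftSeq k, (subsetOf x).1 = S := by
  have hk2 := two_le_of_atLeastTwo k
  let f : Circle → Circle := fun z => e (near S₀ (Function.surjInv e_surjective z))
  have hsub : S₀.1.carrier ⊆ f '' S.carrier := by
    intro p hp
    obtain ⟨z, hz, hzp⟩ := hS.2 p hp
    refine ⟨z, hz, ?_⟩
    have hx := Function.surjInv_eq e_surjective z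
    rw [← hx] at hzp
    obtain ⟨l, rfl, hl⟩ := mem_arc.1 hzp
    simp only [f]
    rw [near_eq hp hl]
  have h1 := Set.ncard_le_ncard hsub (S.finite.image f)
  have h2 := Set.ncard_image_le (f := f) S.finite
  have h3 := S₀.ncard_bounds.1
  have hmem : S ∉ Set.range (incl (X := Circle) (l := k - 2) (k := k) (Nat.sub_le k 2)) := by
    rw [notMem_range_incl]; omega
  obtain ⟨x, hx⟩ := surjective_subsetOf (⟨S, hmem⟩ : StratumCompl k)
  exact ⟨x, congrArg Subtype.val hx⟩

theorem isQuotientMap_ofTuple_e :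
    IsQuotientMap fun v : Fin k → ℝ => (ofTuple fun i => e (v i) : FinSubsetSpace k Circle) := by
  have h1 : IsOpenQuotientMap (Pi.map fun _ : Fin k => e) :=
    IsOpenQuotientMap.piMap fun _ => ⟨e_surjective, continuous_e, isOpenMap_e⟩
  have h2 : IsQuotientMap (ofTuple (k := k) (X := Circle)) := ⟨⟨rfl⟩, exists_ofTuple⟩
  exact h2.comp h1.isQuotientMap

/-- The homotopy contracting a small neighbourhood of `S₀` to `S₀`, defined through a chosen lift;
by `carrier_collapseHomotopy` it does not depend on the choice. -/
def collapseHomotopy (S₀ : StratumCompl k) (p : nbhd S₀ (sepRadius S₀) × I) : StratumCompl k :=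
  have h := exists_lift_of_mem_nbhd p.1.2
  subsetOf (segLift h.choose (collapse S₀ h.choose (by rw [h.choose_spec]; exact p.1.2)) p.2)

theorem carrier_collapseHomotopy (S₀ : StratumCompl k) (p : nbhd S₀ (sepRadius S₀) × I) :
    (collapseHomotopy S₀ p).1.carrier = collapseSet S₀ p.1.1.carrier p.2 := by
  have h := exists_lift_of_mem_nbhd p.1.2
  rw [collapseHomotopy, carrier_segLift_collapse, h.choose_spec]

/-- Continuity may be checked on tuples of real numbers: `ℝ ^ k → exp_k(S¹)` is a quotient map and
remains one after restriction to an open set and taking the product with the interval. There the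
nearest points over `S₀` are locally constant functions. -/
theorem continuous_collapseHomotopy (S₀ : StratumCompl k) :
    Continuous (collapseHomotopy S₀) := by
  refine continuous_induced_rng.2 ?_
  refine (isQuotientMap_ofTuple_e.restrictPreimage_isOpen
    (isOpen_nbhd S₀ (sepRadius S₀))).continuous_lift_prod_left ?_
  have heq : (fun p : ((fun v : Fin k → ℝ => (ofTuple fun i => e (v i) : FinSubsetSpace k Circle))
      ⁻¹' nbhd S₀ (sepRadius S₀)) × I =>
      (Subtype.val ∘ collapseHomotopy S₀) (Set.restrictPreimage _ _ p.1, p.2)) =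
      fun p => ofTuple fun i => e ((1 - (p.2 : ℝ)) * p.1.1 i + p.2 * near S₀ (p.1.1 i)) := by
    funext p
    refine FinSubsetSpace.ext ?_
    exact (carrier_collapseHomotopy S₀ _).trans (range_collapse p.1.2 p.2).symm
  rw [heq]
  refine continuous_ofTuple.comp (continuous_pi fun i => continuous_e.comp ?_)
  have hcoord : Continuous fun p : ((fun v : Fin k → ℝ =>
      (ofTuple fun i => e (v i) : FinSubsetSpace k Circle)) ⁻¹' nbhd S₀ (sepRadius S₀)) × I =>
      p.1.1 i := (continuous_apply i).comp (continuous_subtype_val.comp continuous_fst)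
  have hnear : Continuous fun p : ((fun v : Fin k → ℝ =>
      (ofTuple fun i => e (v i) : FinSubsetSpace k Circle)) ⁻¹' nbhd S₀ (sepRadius S₀)) × I =>
      near S₀ (p.1.1 i) := by
    refine continuous_iff_continuousAt.2 fun p => ?_
    refine (continuousAt_const (y := near S₀ (p.1.1 i))).congr ?_
    filter_upwards [hcoord.continuousAt.eventually
      (eventually_near_eq p.1.2 (x := p.1.1 i) ⟨i, rfl⟩)] with q hq using hq.symm
  have htime : Continuous fun p : ((fun v : Fin k → ℝ =>
      (ofTuple fun i => e (v i) : FinSubsetSpace k Circle)) ⁻¹' nbhd S₀ (sepRadius S₀)) × I =>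
      (p.2 : ℝ) := continuous_subtype_val.comp continuous_snd
  exact ((continuous_const.sub htime).mul hcoord).add (htime.mul hnear)

theorem collapseHomotopy_subsetOf {S₀ : StratumCompl k} {x : LiftSeq k}
    (hx : (subsetOf x).1 ∈ nbhd S₀ (sepRadius S₀)) (t : I) :
    collapseHomotopy S₀ (⟨(subsetOf x).1, hx⟩, t) = subsetOf (segLift x (collapse S₀ x hx) t) :=
  StratumCompl.ext (by rw [carrier_collapseHomotopy, carrier_segLift_collapse hx])

/-- The two ways around the image of a square are homotopic. -/
theorem mk_trans_mk_eq_of_square {X : Type*} [TopologicalSpace X] (K : C(I × I, X)) {a b c d : X}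
    (p : Path a b) (q : Path b d) (r : Path a c) (s : Path c d) (hp : ∀ t, p t = K (t, 0))
    (hq : ∀ t, q t = K (1, t)) (hr : ∀ t, r t = K (0, t)) (hs : ∀ t, s t = K (t, 1)) :
    (Path.Homotopic.Quotient.mk p).trans (Path.Homotopic.Quotient.mk q) =
      (Path.Homotopic.Quotient.mk r).trans (Path.Homotopic.Quotient.mk s) := by
  obtain rfl : K (0, 0) = a := by rw [← hp, p.source]
  obtain rfl : K (1, 0) = b := by rw [← hp, p.target]
  obtain rfl : K (0, 1) = c := by rw [← hr, r.target]
  obtain rfl : K (1, 1) = d := by rw [← hq, q.target]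
  let u : Path (0 : I) 1 := ⟨ContinuousMap.id I, rfl, rfl⟩
  have hp' : p = (u.prod (Path.refl 0)).map K.continuous := Path.ext (funext hp)
  have hq' : q = ((Path.refl 1).prod u).map K.continuous := Path.ext (funext hq)
  have hr' : r = ((Path.refl 0).prod u).map K.continuous := Path.ext (funext hr)
  have hs' : s = (u.prod (Path.refl 1)).map K.continuous := Path.ext (funext hs)
  rw [hp', hq', hr', hs', ← Path.Homotopic.Quotient.mk_trans, ← Path.Homotopic.Quotient.mk_trans,
    ← Path.map_trans, ← Path.map_trans, Path.Homotopic.Quotient.eq]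
  have : ContractibleSpace I := (convex_Icc (0 : ℝ) 1).contractibleSpace ⟨0, unitInterval.zero_mem⟩
  exact (SimplyConnectedSpace.paths_homotopic _ _).map K

/-- Inside a small neighbourhood of `S₀`, every path is homotopic to the straight path from one
lift to its collapse, followed by a straight path to a lift of the endpoint. -/
theorem mk_eq_of_mem_nbhd {S₀ : StratumCompl k} {x y : LiftSeq k}
    (hx : (subsetOf x).1 ∈ nbhd S₀ (sepRadius S₀)) (hy : (subsetOf y).1 ∈ nbhd S₀ (sepRadius S₀))
    (p : Path (subsetOf x) (subsetOf y)) (hp : ∀ t, (p t).1 ∈ nbhd S₀ (sepRadius S₀)) :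
    Path.Homotopic.Quotient.mk p =
      (liftClass x (collapse S₀ x hx) rfl (subsetOf_collapse hx)).trans
        (liftClass (collapse S₀ y hy) y (subsetOf_collapse hy) rfl) := by
  let K : C(I × I, StratumCompl k) :=
    ⟨fun q => collapseHomotopy S₀ (⟨(p q.1).1, hp q.1⟩, q.2),
      (continuous_collapseHomotopy S₀).comp (Continuous.prodMk (Continuous.subtype_mk
        (continuous_subtype_val.comp (p.continuous.comp continuous_fst)) _) continuous_snd)⟩
  have hK : ∀ s t (z : LiftSeq k) (hz : (subsetOf z).1 ∈ nbhd S₀ (sepRadius S₀)),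
      p s = subsetOf z → K (s, t) = subsetOf (segLift z (collapse S₀ z hz) t) := by
    intro s t z hz h
    rw [← collapseHomotopy_subsetOf hz]
    change collapseHomotopy S₀ (⟨(p s).1, hp s⟩, t) = _
    congr 3
    exact congrArg Subtype.val h
  have side : ∀ (z : LiftSeq k) (hz : (subsetOf z).1 ∈ nbhd S₀ (sepRadius S₀)) (t : I),
      ((segPath z (collapse S₀ z hz)).map continuous_subsetOf).cast rfl
        (subsetOf_collapse hz).symm t = subsetOf (segLift z (collapse S₀ z hz) t) :=
    fun _ _ _ => rfl
  have hsq := mk_trans_mk_eq_of_square K p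
    (((segPath y (collapse S₀ y hy)).map continuous_subsetOf).cast rfl (subsetOf_collapse hy).symm)
    (((segPath x (collapse S₀ x hx)).map continuous_subsetOf).cast rfl (subsetOf_collapse hx).symm)
    (Path.refl S₀) (fun s => ?_) (fun t => ?_) (fun t => ?_) (fun s => ?_)
  · rw [Path.Homotopic.Quotient.mk_refl, Path.Homotopic.Quotient.trans_refl,
      mk_eq_liftClass rfl (subsetOf_collapse hy) (segPath y (collapse S₀ y hy)) _ (side y hy),
      mk_eq_liftClass rfl (subsetOf_collapse hx) (segPath x (collapse S₀ x hx)) _ (side x hx)] at hsq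
    rw [← hsq, Path.Homotopic.Quotient.trans_assoc, liftClass_trans, liftClass_self,
      Path.Homotopic.Quotient.trans_refl]
  · obtain ⟨z, hz⟩ := surjective_subsetOf (p s)
    have hz' : (subsetOf z).1 ∈ nbhd S₀ (sepRadius S₀) := by rw [hz]; exact hp s
    rw [hK s 0 z hz' hz.symm, ← hz]
    congr 1
    exact (segPath z (collapse S₀ z hz')).source.symm
  · rw [hK 1 t y hy p.target]; rfl
  · rw [hK 0 t x hx p.source]; rfl
  · obtain ⟨z, hz⟩ := surjective_subsetOf (p s)
    have hz' : (subsetOf z).1 ∈ nbhd S₀ (sepRadius S₀) := by rw [hz]; exact hp s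
    rw [hK s 1 z hz' hz.symm, Path.refl_apply]
    exact (subsetOf_collapse hz').symm.trans
      (congrArg subsetOf (segPath z (collapse S₀ z hz')).target.symm)

/-! ### The two loops generate the fundamental group -/

/-- A homotopy class of paths is generated by the subgroup `H` if every loop obtained by joining
its ends to the basepoint through straight paths of lifts lies in `H`. -/
def GeneratedBy (z : LiftSeq k) (H : Subgroup (FundamentalGroup (StratumCompl k) (subsetOf z)))
    {S T : StratumCompl k} (p : Path.Homotopic.Quotient S T) : Prop :=
  ∀ (x y : LiftSeq k) (hx : subsetOf x = S) (hy : subsetOf y = T),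
    ((liftClass z x rfl hx).trans (p.trans (liftClass y z hy rfl)) :
      Path.Homotopic.Quotient (subsetOf z) (subsetOf z)) ∈ H

theorem GeneratedBy.trans {z : LiftSeq k}
    {H : Subgroup (FundamentalGroup (StratumCompl k) (subsetOf z))}
    {S T U : StratumCompl k} {p : Path.Homotopic.Quotient S T} {q : Path.Homotopic.Quotient T U}
    (hp : GeneratedBy z H p) (hq : GeneratedBy z H q) : GeneratedBy z H (p.trans q) := by
  intro x y hx hy
  obtain ⟨u, hu⟩ := surjective_subsetOf T
  have h := H.mul_mem (hq u y hu hy) (hp x u hx hu)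
  rw [FundamentalGroup.mul_def, ← Path.Homotopic.Quotient.trans_assoc (liftClass z x _ _),
    trans_cancel _ _ _ _ (by rw [liftClass_trans, liftClass_self])] at h
  simpa only [Path.Homotopic.Quotient.trans_assoc] using h

theorem generatedBy_liftClass {z : LiftSeq k} {w : StrictSeq (k - 1)} (x y : LiftSeq k)
    {S T : StratumCompl k} (hS : subsetOf x = S) (hT : subsetOf y = T) :
    GeneratedBy z (Subgroup.closure {rotClass z, faceRotClass z w}) (liftClass x y hS hT) := by
  intro x' y' hx' hy'
  have h := Subgroup.mul_mem _ (jump_mem z w (hT.trans hy'.symm)) (jump_mem z w (hx'.trans hS.symm))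
  rw [FundamentalGroup.mul_def, ← trans_eq_jump z _ _ hT hy', ← trans_eq_jump z _ _ hx' hS,
    ← liftClass_trans z x y rfl hS hT, Path.Homotopic.Quotient.trans_assoc (liftClass z x _ _),
    trans_cancel _ _ _ _ (by rw [liftClass_trans, liftClass_self])] at h
  exact h

/-- Subdividing a path into pieces in small neighbourhoods shows that `α` and `β` generate. -/
theorem generatedBy_closure (z : LiftSeq k) (w : StrictSeq (k - 1)) {S T : StratumCompl k}
    (p : Path S T) :
    GeneratedBy z (Subgroup.closure {rotClass z, faceRotClass z w})
      (Path.Homotopic.Quotient.mk p) := by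
  let V : StratumCompl k → Set (StratumCompl k) := fun S₀ => {S | S.1 ∈ nbhd S₀ (sepRadius S₀)}
  have hV : ∀ S₀, IsOpen (V S₀) := fun S₀ => (isOpen_nbhd S₀ _).preimage continuous_subtype_val
  obtain ⟨t, ht0, htm, ⟨n, hn⟩, ht⟩ := exists_monotone_Icc_subset_open_cover_unitInterval
    (c := fun S₀ => p ⁻¹' V S₀) (fun S₀ => (hV S₀).preimage p.continuous)
    (fun s _ => Set.mem_iUnion.2 ⟨p s, self_mem_nbhd _ (sepRadius_pos _)⟩)
  have small : ∀ {S T : StratumCompl k} (q : Path S T) (S₀ : StratumCompl k),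
      (∀ s, q s ∈ V S₀) → GeneratedBy z (Subgroup.closure {rotClass z, faceRotClass z w})
        (Path.Homotopic.Quotient.mk q) := by
    intro S T q S₀ hq
    obtain ⟨x, rfl⟩ := surjective_subsetOf S
    obtain ⟨y, rfl⟩ := surjective_subsetOf T
    rw [mk_eq_of_mem_nbhd (by have := hq 0; rwa [q.source] at this)
      (by have := hq 1; rwa [q.target] at this) q hq]
    exact (generatedBy_liftClass _ _ _ _).trans (generatedBy_liftClass _ _ _ _)
  have step : ∀ m, GeneratedBy z (Subgroup.closure {rotClass z, faceRotClass z w})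
      (Path.Homotopic.Quotient.mk (p.subpath 0 (t m))) := by
    intro m
    induction m with
    | zero =>
      refine small _ (p 0) fun s => ?_
      rw [ht0, Path.subpath_self]
      exact self_mem_nbhd _ (sepRadius_pos _)
    | succ m ih =>
      obtain ⟨S₀, hS₀⟩ := ht m
      rw [← Path.Homotopic.Quotient.eq.2
        ⟨Path.Homotopy.subpathTransSubpath p 0 (t m) (t (m + 1))⟩]
      refine ih.trans (small _ S₀ fun s => ?_)
      have hr : p.subpath (t m) (t (m + 1)) s ∈ Set.range (p.subpath (t m) (t (m + 1))) := ⟨s, rfl⟩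
      rw [Path.range_subpath_of_le _ _ _ (htm (Nat.le_succ m))] at hr
      obtain ⟨u, hu, hus⟩ := hr
      rw [← hus]
      exact hS₀ hu
  have h := step n
  rw [hn n le_rfl, Path.subpath_zero_one] at h
  obtain ⟨p, rfl, rfl⟩ := p
  exact h

theorem closure_eq_top (z : LiftSeq k) (w : StrictSeq (k - 1)) :
    Subgroup.closure {rotClass z, faceRotClass z w} = ⊤ := by
  refine eq_top_iff.2 fun p _ => ?_
  obtain ⟨p, rfl⟩ := Path.Homotopic.Quotient.mk_surjective p
  have h := generatedBy_closure z w p z z rfl rfl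
  rwa [liftClass_self, Path.Homotopic.Quotient.trans_refl,
    Path.Homotopic.Quotient.refl_trans] at h

end

end

/-! ### A potential on the space of lifts -/

/-- The sum of the integer parts over one period. -/
def floorSum (m : ℕ) (x : ℤ → ℝ) : ℤ := ∑ i ∈ Finset.range m, ⌊x (i : ℕ)⌋

theorem floorSum_shift {m : ℕ} {x : ℤ → ℝ} (hx : IsPeriodic m x) :
    floorSum m (fun i => x (i + 1)) = floorSum m x + 1 := by
  have h1 := Finset.sum_range_succ (fun i : ℕ => ⌊x (i : ℕ)⌋) m
  have h2 := Finset.sum_range_succ' (fun i : ℕ => ⌊x (i : ℕ)⌋) m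
  have h3 : ⌊x ((m : ℕ) : ℤ)⌋ = ⌊x ((0 : ℕ) : ℤ)⌋ + 1 := by
    have := hx 0
    rw [zero_add] at this
    rw [this, Int.floor_add_one]; rfl
  simp only [floorSum]
  push_cast at h1 h2 h3 ⊢
  linarith

theorem floorSum_add_int (m : ℕ) (x : ℤ → ℝ) (q : ℤ) :
    floorSum m (fun i => x i + q) = floorSum m x + m * q := by
  simp [floorSum, Finset.sum_add_distrib]

section

variable {G : Type*} [Group G] {k : ℕ}

/-- A function on lifts that is multiplied by `a` on the right under a shift of `k`-tuples, and
by `b` under a shift of `(k - 1)`-tuples, provided that `a ^ k = b ^ (k - 1)`. On lifts without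
coincidence the exponent of `a` is the number of shifts separating `x` from the lift whose entries
`x 0, …, x (k - 1)` lie in `[0, 1)`. A lift with a coincidence becomes a doubled sequence after
`n` shifts; its exponent of `b` counts the shifts of the underlying `(k - 1)`-periodic sequence in
the same way, and `a ^ (-n)` accounts for the shifts of `x`. By `potential_welldefined` the choice
of `n` is immaterial. -/
def potential (k : ℕ) (a b : G) (x : ℤ → ℝ) : G :=
  open Classical in
  if h : ∃ (n : ℤ) (w : ℤ → ℝ), w ∈ StrictSeq (k - 1) ∧ ∀ i, x (i + n) = dup k w i then
    b ^ floorSum (k - 1) h.choose_spec.choose * a ^ (-h.choose)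
  else a ^ floorSum k x

variable [hk : k.AtLeastTwo]

/-- Two choices of `n` differ by a multiple `k * q` of the period; the underlying sequences then
differ by the translation by `q`, and `a ^ (k * q) = b ^ ((k - 1) * q)`. -/
theorem potential_welldefined {a b : G} (hab : a ^ k = b ^ (k - 1)) {x v w : ℤ → ℝ}
    (hx : x ∈ LiftSeq k) {m n : ℤ} (hv : ∀ i, x (i + m) = dup k v i)
    (hw : ∀ i, x (i + n) = dup k w i) :
    b ^ floorSum (k - 1) v * a ^ (-m) = b ^ floorSum (k - 1) w * a ^ (-n) := by
  have coin : ∀ (m : ℤ) (v : ℤ → ℝ), (∀ i, x (i + m) = dup k v i) → x (m + 1) = x m := by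
    intro m v hv
    have h0 := hv 0
    have h1 := hv 1
    rw [zero_add] at h0
    rw [add_comm, h1, h0]
    exact congrArg v (dupIndex_succ_of_dvd (k := k) (dvd_zero _))
  obtain ⟨q, hq⟩ := hx.2.2 m n (coin m v hv) (coin n w hw)
  have hwv : w = fun j => v j + q := by
    funext j
    have h1 := hv (dupSection k j)
    have h2 := hw (dupSection k j)
    simp only [dup, dupIndex_dupSection] at h1 h2
    rw [← h1, ← h2, ← hx.2.1.add_mul]
    congr 1
    linarith
  rw [hwv, floorSum_add_int, show n = m + k * q by linarith, neg_add_rev, zpow_add, zpow_add,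
    ← mul_neg, zpow_mul, zpow_mul a, zpow_natCast, zpow_natCast, hab]
  simp [mul_assoc]

theorem potential_of_dup {a b : G} (hab : a ^ k = b ^ (k - 1)) {x w : ℤ → ℝ} (hx : x ∈ LiftSeq k)
    {n : ℤ} (hw : ∀ i, x (i + n) = dup k w i) :
    potential k a b x = b ^ floorSum (k - 1) w * a ^ (-n) := by
  have hw' : w ∈ StrictSeq (k - 1) := mem_strictSeq_of_dup_mem (by
    rw [← funext hw]; exact LiftSeq.shift hx n)
  have h : ∃ (n : ℤ) (w : ℤ → ℝ), w ∈ StrictSeq (k - 1) ∧ ∀ i, x (i + n) = dup k w i :=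
    ⟨n, w, hw', hw⟩
  rw [potential, dif_pos h]
  exact potential_welldefined hab hx h.choose_spec.choose_spec.2 hw

theorem potential_shift {a b : G} (hab : a ^ k = b ^ (k - 1)) {x : ℤ → ℝ} (hx : x ∈ LiftSeq k) :
    potential k a b (fun i => x (i + 1)) = potential k a b x * a := by
  by_cases h : ∃ (n : ℤ) (w : ℤ → ℝ), w ∈ StrictSeq (k - 1) ∧ ∀ i, x (i + n) = dup k w i
  · obtain ⟨n, w, -, hxw⟩ := h
    have hs : ∀ i, (fun i => x (i + 1)) (i + (n - 1)) = dup k w i := fun i => by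
      rw [← hxw]; simp only; congr 1; ring
    rw [potential_of_dup hab hx hxw, potential_of_dup hab (LiftSeq.shift hx 1) hs, mul_assoc,
      ← zpow_add_one]
    congr 2; ring
  · have h' : ¬ ∃ (n : ℤ) (w : ℤ → ℝ), w ∈ StrictSeq (k - 1) ∧
        ∀ i, (fun i => x (i + 1)) (i + n) = dup k w i := by
      rintro ⟨n, w, hw, hxw⟩
      exact h ⟨n + 1, w, hw, fun i => by rw [← hxw, ← add_assoc]⟩
    rw [potential, potential, dif_neg h, dif_neg h', floorSum_shift hx.2.1, zpow_add_one]

theorem potential_dup {a b : G} (hab : a ^ k = b ^ (k - 1)) {w : ℤ → ℝ}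
    (hw : w ∈ StrictSeq (k - 1)) : potential k a b (dup k w) = b ^ floorSum (k - 1) w := by
  rw [potential_of_dup hab (dup_mem hw) (w := w) (n := 0) fun i => by rw [add_zero]]
  simp

theorem potential_dup_shift {a b : G} (hab : a ^ k = b ^ (k - 1)) {w : ℤ → ℝ}
    (hw : w ∈ StrictSeq (k - 1)) :
    potential k a b (dup k fun i => w (i + 1)) = potential k a b (dup k w) * b := by
  rw [potential_dup hab hw, potential_dup hab (StrictSeq.shift hw 1), floorSum_shift hw.2,
    zpow_add_one]

/-! ### The covering space with prescribed holonomy -/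

/-- The change of the potential between a lift of `S` and the nearby lift of `S₀`. The lift is
chosen; for `S` near `S₀` every lift gives the same value, see `transition_subsetOf`. -/
def transition (a b : G) (S₀ S : StratumCompl k) : G :=
  potential k a b (Function.surjInv surjective_subsetOf S).1 *
    (potential k a b fun i => near S₀ ((Function.surjInv surjective_subsetOf S).1 i))⁻¹

/-- The change of the potential does not depend on the lift, because collapsing commutes with
both shifts. -/
theorem transition_subsetOf {a b : G} (hab : a ^ k = b ^ (k - 1)) {S₀ : StratumCompl k}
    {x : LiftSeq k} (hx : (subsetOf x).1 ∈ nbhd S₀ (sepRadius S₀)) :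
    transition a b S₀ (subsetOf x) =
      potential k a b x.1 * (potential k a b fun i => near S₀ (x.1 i))⁻¹ := by
  let u : LiftSeq k → G := fun x =>
    potential k a b x.1 * (potential k a b fun i => near S₀ (x.1 i))⁻¹
  have key := fiber_induction (P := fun x y => subsetOf x = subsetOf y ∧
      ((subsetOf x).1 ∈ nbhd S₀ (sepRadius S₀) → u x = u y))
    ⟨fun x => ⟨rfl, fun _ => rfl⟩, fun {x y} h => ⟨h.1.symm, fun hy => (h.2 (by rwa [h.1])).symm⟩,
      fun {x y z} h h' => ⟨h.1.trans h'.1, fun hx => (h.2 hx).trans (h'.2 (by rwa [← h.1]))⟩⟩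
    (fun x => ⟨(subsetOf_shiftLift x).symm, fun hx => ?_⟩)
    (fun w => ⟨(subsetOf_dupLift_shiftStrict w).symm, fun hw => ?_⟩)
    (Function.surjInv_eq surjective_subsetOf (subsetOf x))
  · exact key.2 (by rwa [key.1])
  · have h1 := potential_shift hab x.2
    have h2 := potential_shift hab (near_mem_liftSeq hx)
    change _ = (potential k a b fun i => x.1 (i + 1)) *
      (potential k a b fun i => near S₀ (x.1 (i + 1)))⁻¹
    rw [h1, h2]
    simp only [u]
    group
  · have hn : (fun i => near S₀ (w.1 i)) ∈ StrictSeq (k - 1) :=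
      mem_strictSeq_of_dup_mem (near_mem_liftSeq hw)
    have h1 := potential_dup_shift hab w.2
    have h2 := potential_dup_shift hab hn
    change _ = potential k a b (dup k fun i => w.1 (i + 1)) *
      (potential k a b (dup k fun i => near S₀ (w.1 (i + 1))))⁻¹
    rw [h1, h2]
    change potential k a b (dup k w.1) *
      (potential k a b (dup k fun i => near S₀ (w.1 i)))⁻¹ = _
    group

theorem transition_self {a b : G} (hab : a ^ k = b ^ (k - 1)) (S : StratumCompl k) :
    transition a b S S = 1 := by
  obtain ⟨x, rfl⟩ := surjective_subsetOf S
  rw [transition_subsetOf hab (self_mem_nbhd _ (sepRadius_pos _))]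
  simp only [near_self (e_mem_subsetOf x _)]
  group

/-- The cocycle identity: collapsing to `S` and then to `S₀` is collapsing to `S₀`. The radius
about `S` is limited by `sepRadius S₀` so that the three displacements together stay below the
separation of the points over `S₀`. -/
theorem transition_mul {a b : G} (hab : a ^ k = b ^ (k - 1)) {S₀ S S' : StratumCompl k}
    (hS : S.1 ∈ nbhd S₀ (sepRadius S₀)) (hS' : S'.1 ∈ nbhd S₀ (sepRadius S₀))
    (h : S'.1 ∈ nbhd S (min (sepRadius S) (sepRadius S₀))) :
    transition a b S S' * transition a b S₀ S = transition a b S₀ S' := by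
  obtain ⟨x, rfl⟩ := surjective_subsetOf S'
  have hxS := nbhd_mono S (min_le_left _ _) h
  obtain ⟨y, h1, rfl⟩ : ∃ y : LiftSeq k, (∀ i, near S (x.1 i) = y.1 i) ∧ subsetOf y = S :=
    ⟨collapse S x hxS, fun _ => rfl, subsetOf_collapse hxS⟩
  rw [transition_subsetOf hab hS, transition_subsetOf hab hS', transition_subsetOf hab hxS]
  have h2 : ∀ i, near S₀ (y.1 i) = near S₀ (x.1 i) := by
    intro i
    have a1 := near_spec le_rfl hS (e_mem_subsetOf y i)
    have a2 := near_spec le_rfl hS' (e_mem_subsetOf x i)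
    have a3 := near_spec (min_le_left _ _) h (e_mem_subsetOf x i)
    rw [h1] at a3
    refine eq_of_abs_sub_lt a1.1 a2.1 ?_
    have b1 := abs_lt.1 a1.2
    have b2 := abs_lt.1 a2.2
    have b3 := abs_lt.1 (a3.2.trans_le (min_le_right _ _))
    rw [abs_lt]; constructor <;> linarith
  simp only [h1, h2]
  group

variable [TopologicalSpace G] [DiscreteTopology G]

/-- The principal covering whose transition functions are given by the potential; its charts are
indexed by the centres of the small neighbourhoods. -/
def holonomyCore {a b : G} (hab : a ^ k = b ^ (k - 1)) :
    FiberBundleCore (StratumCompl k) (StratumCompl k) G where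
  baseSet S₀ := {S | S.1 ∈ nbhd S₀ (sepRadius S₀)}
  isOpen_baseSet S₀ := (isOpen_nbhd S₀ _).preimage continuous_subtype_val
  indexAt S := S
  mem_baseSet_at S := self_mem_nbhd S (sepRadius_pos S)
  coordChange S₀ S₁ S v := (transition a b S₁ S)⁻¹ * transition a b S₀ S * v
  coordChange_self S₀ S _ v := by simp
  continuousOn_coordChange S₀ S₁ := by
    rintro ⟨S, v⟩ ⟨⟨h0, h1⟩, -⟩
    refine ContinuousAt.continuousWithinAt ?_
    have hc : ContinuousAt (fun p : StratumCompl k × G =>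
        (transition a b S₁ S)⁻¹ * transition a b S₀ S * p.2) (S, v) :=
      ((continuous_of_discreteTopology (f := fun v : G =>
        (transition a b S₁ S)⁻¹ * transition a b S₀ S * v)).comp continuous_snd).continuousAt
    refine hc.congr ?_
    have ev : ∀ (T : StratumCompl k) (ε : ℝ), S.1 ∈ nbhd T ε →
        ∀ᶠ p : StratumCompl k × G in 𝓝 (S, v), p.1.1 ∈ nbhd T ε := fun T ε h =>
      ((isOpen_nbhd T ε).preimage (continuous_subtype_val.comp continuous_fst)).mem_nhds h
    have e0 := ev S _ (self_mem_nbhd S (lt_min (sepRadius_pos S) (sepRadius_pos S₀)))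
    have e1 := ev S _ (self_mem_nbhd S (lt_min (sepRadius_pos S) (sepRadius_pos S₁)))
    -- near `S` both transition functions factor through `S`, so their ratio is constant
    filter_upwards [ev _ _ h0, ev _ _ h1, e0, e1] with p p0 p1 q0 q1
    rw [← transition_mul hab h0 p0 q0, ← transition_mul hab h1 p1 q1]
    group
  coordChange_comp S₀ S₁ S₂ S _ v := by group

theorem isCoveringMap_holonomyCore {a b : G} (hab : a ^ k = b ^ (k - 1)) :
    IsCoveringMap (holonomyCore hab).proj :=
  FiberBundle.isCoveringMap

/-- The lift of `subsetOf` to the covering given by the potential. -/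
def potentialLift {a b : G} (hab : a ^ k = b ^ (k - 1)) (g : G) (x : LiftSeq k) :
    (holonomyCore hab).TotalSpace :=
  ⟨subsetOf x, (potential k a b x.1 * g : G)⟩

/-- For lifts `y` close to `x`, the collapse of `y` onto the set below `x` is `x` itself. -/
theorem eventually_near_eq_self (x : LiftSeq k) :
    ∀ᶠ y : LiftSeq k in 𝓝 x, (fun i => near (subsetOf x) (y.1 i)) = x.1 := by
  have hk2 := two_le_of_atLeastTwo k
  have ho : IsOpen {y : LiftSeq k | ∀ i : Fin k,
      |y.1 (i : ℕ) - x.1 (i : ℕ)| < sepRadius (subsetOf x)} := by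
    simp only [Set.ofPred_forall]
    refine isOpen_iInter_of_finite fun i => isOpen_lt ?_ continuous_const
    exact (((continuous_apply _).comp continuous_subtype_val).sub continuous_const).abs
  have hx : x ∈ {y : LiftSeq k | ∀ i : Fin k,
      |y.1 (i : ℕ) - x.1 (i : ℕ)| < sepRadius (subsetOf x)} := fun i => by
    simpa using sepRadius_pos _
  filter_upwards [ho.mem_nhds hx] with y hy
  funext i
  have h0 := Int.emod_nonneg i (b := k) (by omega)
  have h1 := Int.emod_lt_of_pos i (b := k) (by omega)
  refine near_eq (e_mem_subsetOf x i) ?_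
  have := hy ⟨(i % k).toNat, by omega⟩
  simp only [Int.toNat_of_nonneg h0] at this
  rwa [x.2.2.1.eq_emod i, y.2.2.1.eq_emod i, add_sub_add_right_eq_sub]

theorem continuous_potentialLift {a b : G} (hab : a ^ k = b ^ (k - 1)) (g : G) :
    Continuous (potentialLift hab g) := by
  refine continuous_iff_continuousAt.2 fun x => ?_
  refine (FiberBundle.continuousAt_totalSpace _ _).2 ⟨continuous_subsetOf.continuousAt, ?_⟩
  refine (continuousAt_const (y := potential k a b x.1 * g)).congr ?_
  have hopen : ∀ᶠ y in 𝓝 x, (subsetOf y).1 ∈ nbhd (subsetOf x) (sepRadius (subsetOf x)) :=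
    ((isOpen_nbhd _ _).preimage (continuous_subtype_val.comp continuous_subsetOf)).mem_nhds
      (self_mem_nbhd _ (sepRadius_pos _))
  filter_upwards [hopen, eventually_near_eq_self x] with y hy hyx
  change _ = (transition a b (subsetOf x) (subsetOf y))⁻¹ *
    transition a b (subsetOf y) (subsetOf y) * (potential k a b y.1 * g)
  rw [transition_self hab, transition_subsetOf hab hy, hyx]
  group

/-- Monodromy along the class of a path between lifts. -/
theorem monodromy_liftClass {a b : G} (hab : a ^ k = b ^ (k - 1)) (x y : LiftSeq k)
    {S T : StratumCompl k} (hS : subsetOf x = S) (hT : subsetOf y = T) (v : G) :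
    (isCoveringMap_holonomyCore hab).monodromy (liftClass x y hS hT)
        ⟨(⟨S, v⟩ : (holonomyCore hab).TotalSpace), rfl⟩ =
      ⟨(⟨T, (potential k a b y.1 * (potential k a b x.1)⁻¹ * v : G)⟩ :
        (holonomyCore hab).TotalSpace), rfl⟩ := by
  subst hS hT
  have h := (isCoveringMap_holonomyCore hab).monodromy_map (Path.Homotopic.Quotient.mk
    ((segPath x y).map (continuous_potentialLift hab ((potential k a b x.1)⁻¹ * v))))
  have h1 : (⟨subsetOf x, v⟩ : (holonomyCore hab).TotalSpace) =
      potentialLift hab ((potential k a b x.1)⁻¹ * v) x := by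
    simp [potentialLift]
  have h2 : (⟨subsetOf y, (potential k a b y.1 * (potential k a b x.1)⁻¹ * v : G)⟩ :
      (holonomyCore hab).TotalSpace) = potentialLift hab ((potential k a b x.1)⁻¹ * v) y := by
    simp [potentialLift, mul_assoc]
  have h3 := mk_eq_liftClass rfl rfl (segPath x y)
    ((segPath x y).map continuous_subsetOf) fun _ => rfl
  simp only [h1, h2]
  rw [← h3]
  exact h

end

section

variable {k : ℕ} [hk : k.AtLeastTwo]

/-! ### The presentation -/

theorem potential_of_strict {G : Type*} [Group G] (a b : G) {x : ℤ → ℝ} (hx : x ∈ StrictSeq k) :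
    potential k a b x = a ^ floorSum k x := by
  refine dif_neg ?_
  rintro ⟨n, w, -, hw⟩
  have h0 := hw 0
  have h1 := hw 1
  have hd : dup k w 1 = dup k w 0 := congrArg w (dupIndex_succ_of_dvd (k := k) (dvd_zero _))
  rw [← hd, ← h1] at h0
  have := hx.1.injective h0
  omega

theorem floorSum_evenStrict (m : ℕ) (hm : 0 < m) : floorSum m (evenStrict m hm).1 = 0 := by
  refine Finset.sum_eq_zero fun i hi => ?_
  have hm' : (0 : ℝ) < m := by exact_mod_cast hm
  have hi' : (i : ℝ) < m := by exact_mod_cast Finset.mem_range.1 hi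
  rw [Int.floor_eq_zero_iff]
  change (((i : ℕ) : ℤ) : ℝ) / m ∈ _
  rw [Int.cast_natCast]
  exact ⟨by positivity, (div_lt_one hm').2 hi'⟩

/-- The evenly spaced lift of the `(k - 1)`-th roots of unity. -/
def evenFace (k : ℕ) [hk : k.AtLeastTwo] : StrictSeq (k - 1) :=
  evenStrict (k - 1) (sub_one_pos_of_atLeastTwo k)

/-- A homomorphism from a group generated by `a` and `b` with `a ^ k = b ^ (k - 1)` that sends
`a` and `b` to the two loops is injective: the monodromy of the covering with holonomy `a`, `b`
recovers the regular representation. -/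
theorem injective_of_map_eq {G : Type*} [Group G] {a b : G} (hab : a ^ k = b ^ (k - 1))
    (hgen : Subgroup.closure {a, b} = ⊤)
    (f : G →* FundamentalGroup (StratumCompl k) (subsetOf (evenLift k)))
    (ha : f a = rotClass (evenLift k)) (hb : f b = faceRotClass (evenLift k) (evenFace k)) :
    Function.Injective f := by
  let _ : TopologicalSpace G := ⊥
  have : DiscreteTopology G := ⟨rfl⟩
  let pt : G → (holonomyCore hab).proj ⁻¹' {subsetOf (evenLift k)} := fun v =>
    ⟨(⟨subsetOf (evenLift k), v⟩ : (holonomyCore hab).TotalSpace), rfl⟩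
  let M := (isCoveringMap_holonomyCore hab).monodromyPerm (subsetOf (evenLift k))
  have hz : potential k a b (evenLift k).1 = 1 := by
    rw [evenLift, potential_of_strict a b (evenStrict k _).2, floorSum_evenStrict, zpow_zero]
  have hw : potential k a b (dup k (evenFace k).1) = 1 := by
    rw [potential_dup hab (evenFace k).2, evenFace, floorSum_evenStrict, zpow_zero]
  have hjump : ∀ (x y : LiftSeq k) (h : subsetOf x = subsetOf y) (v : G),
      M (jump (evenLift k) x y h) (pt v) =
        pt ((potential k a b y.1)⁻¹ * potential k a b x.1 * v) := by
    intro x y h v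
    change (isCoveringMap_holonomyCore hab).monodromy ((liftClass _ x rfl rfl).trans
      (liftClass y _ h.symm rfl)) (pt v) = _
    rw [IsCoveringMap.monodromy_trans_apply, monodromy_liftClass, monodromy_liftClass]
    simp only [pt, hz, inv_one, one_mul, mul_one, mul_assoc]
  have key : ∀ g v, M (f g) (pt v) = pt (g * v) := by
    intro g
    have hg : g ∈ Subgroup.closure {a, b} := hgen ▸ Subgroup.mem_top g
    induction hg using Subgroup.closure_induction with
    | mem g hg =>
      intro v
      rcases hg with rfl | rfl
      · rw [ha, rotClass, hjump]
        change pt (_ * potential k g b (fun i => (evenLift k).1 (i + 1)) * v) = _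
        rw [potential_shift hab (evenLift k).2, hz]
        simp
      · rw [hb, faceRotClass, hjump]
        change pt ((potential k a g (dup k (evenFace k).1))⁻¹ *
          potential k a g (dup k fun i => (evenFace k).1 (i + 1)) * v) = _
        rw [potential_dup_shift hab (evenFace k).2, hw]
        simp
    | one => intro v; rw [map_one, map_one, Equiv.Perm.one_apply, one_mul]
    | mul g h _ _ ihg ihh =>
      intro v
      rw [map_mul, map_mul, Equiv.Perm.mul_apply, ihh, ihg, mul_assoc]
    | inv g _ ih =>
      intro v
      rw [map_inv, map_inv, Equiv.Perm.inv_eq_iff_eq, ih, mul_inv_cancel_left]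
  refine (injective_iff_map_eq_one f).2 fun g hg => ?_
  have h := key g 1
  rw [hg, map_one, Equiv.Perm.one_apply, mul_one] at h
  exact (eq_of_heq (Bundle.TotalSpace.mk.inj (congrArg Subtype.val h)).2).symm

theorem torusKnotGroup_relation (k : ℕ) :
    (PresentedGroup.of 0 : TorusKnotGroup k) ^ k = PresentedGroup.of 1 ^ (k - 1) := by
  have h := PresentedGroup.one_of_mem (rels :=
    ({FreeGroup.of 0 ^ k * (FreeGroup.of 1 ^ (k - 1))⁻¹} : Set (FreeGroup (Fin 2))))
    (Set.mem_singleton _)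
  rw [map_mul, map_inv, map_pow, map_pow] at h
  exact mul_inv_eq_one.1 h

theorem torusKnotGroup_closure (k : ℕ) :
    Subgroup.closure {(PresentedGroup.of 0 : TorusKnotGroup k), PresentedGroup.of 1} = ⊤ := by
  rw [← PresentedGroup.closure_range_of]
  congr 1
  ext x
  simp [Fin.exists_fin_two, eq_comm]

/-- The presentation for loops given as classes of lifted paths, with the basepoint `S` kept
abstract because it equals `subsetOf (evenLift k)` only propositionally. -/
theorem exists_mulEquiv_of_eq_liftClass {S : StratumCompl k} (hS : subsetOf (evenLift k) = S)
    (p q : Path.Homotopic.Quotient S S)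
    (hp : p = liftClass (evenLift k) (shiftLift (evenLift k)) hS
      ((subsetOf_shiftLift _).trans hS))
    (hq : q = (liftClass (evenLift k) (dupLift (shiftStrict (evenFace k))) hS
      (subsetOf_dupLift_shiftStrict _)).trans (liftClass (dupLift (evenFace k)) _ rfl hS)) :
    ∃ Φ : TorusKnotGroup k ≃* FundamentalGroup (StratumCompl k) S,
      Φ (PresentedGroup.of 0) = FundamentalGroup.fromPath p ∧
      Φ (PresentedGroup.of 1) = FundamentalGroup.fromPath q := by
  subst hS
  have hp' : p = rotClass (evenLift k) := by
    rw [rotClass, ← trans_eq_jump _ _ _ (subsetOf_shiftLift _) rfl, liftClass_self,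
      Path.Homotopic.Quotient.trans_refl, hp]
  have hq' : q = faceRotClass (evenLift k) (evenFace k) := by
    rw [hq, trans_eq_jump]; rfl
  let gen : Fin 2 → FundamentalGroup (StratumCompl k) (subsetOf (evenLift k)) :=
    ![rotClass (evenLift k), faceRotClass (evenLift k) (evenFace k)]
  have hrel : ∀ r ∈ ({FreeGroup.of 0 ^ k * (FreeGroup.of 1 ^ (k - 1))⁻¹} :
      Set (FreeGroup (Fin 2))), FreeGroup.lift gen r = 1 := by
    rintro _ rfl
    simp [gen, rotClass_pow_eq (evenLift k) (evenFace k)]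
  let f := PresentedGroup.toGroup hrel
  have h0 : f (PresentedGroup.of 0) = rotClass (evenLift k) := PresentedGroup.toGroup.of hrel
  have h1 : f (PresentedGroup.of 1) = faceRotClass (evenLift k) (evenFace k) :=
    PresentedGroup.toGroup.of hrel
  have hinj := injective_of_map_eq (torusKnotGroup_relation k) (torusKnotGroup_closure k) f h0 h1
  have hsurj : Function.Surjective f := by
    rw [← MonoidHom.range_eq_top, eq_top_iff, ← closure_eq_top (evenLift k) (evenFace k),
      Subgroup.closure_le]
    rintro _ (rfl | rfl)
    · exact ⟨_, h0⟩
    · exact ⟨_, h1⟩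
  exact ⟨MulEquiv.ofBijective f ⟨hinj, hsurj⟩, h0.trans hp'.symm, h1.trans hq'.symm⟩

/-! ### The explicit loops -/

theorem range_evenStrict (m : ℕ) (hm : 0 < m) :
    Set.range (e ∘ (evenStrict m hm).1) = rootSet m := by
  rw [← (evenStrict m hm).2.2.range_fin hm, ← range_eq_rootSet m hm.ne']
  rfl

theorem subsetOf_evenLift : subsetOf (evenLift k) = basept k :=
  StratumCompl.ext (range_evenStrict k (pos_of_atLeastTwo k))

theorem subsetOf_dupLift_evenFace :
    subsetOf (dupLift (evenFace k)) = rootsPt k (k - 1) le_rfl (Nat.sub_le k 1) :=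
  StratumCompl.ext (by rw [carrier_subsetOf_dupLift]; exact range_evenStrict (k - 1) (sub_one_pos_of_atLeastTwo k))

theorem even_segment (m : ℕ) (hm : 0 < m) (t : ℝ) (i : ℤ) :
    (1 - t) * (evenStrict m hm).1 i + t * (evenStrict m hm).1 (i + 1) =
      t / m + (evenStrict m hm).1 i := by
  have : (m : ℝ) ≠ 0 := by exact_mod_cast hm.ne'
  simp only [evenStrict]
  push_cast
  field_simp
  ring

theorem image_rotate_rootSet (m : ℕ) (hm : 0 < m) (t : ℝ) :
    (e (t / m) * ·) '' rootSet m = Set.range fun i : ℤ =>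
      e ((1 - t) * (evenStrict m hm).1 i + t * (evenStrict m hm).1 (i + 1)) := by
  rw [← range_evenStrict m hm, ← Set.range_comp]
  congr 1
  funext i
  rw [even_segment, e_add]; rfl

theorem mk_alpha_eq : Path.Homotopic.Quotient.mk (alpha k) =
    liftClass (evenLift k) (shiftLift (evenLift k)) subsetOf_evenLift
      ((subsetOf_shiftLift _).trans subsetOf_evenLift) := by
  refine mk_eq_liftClass _ _ (segPath _ _) _ fun t => StratumCompl.ext ?_
  exact image_rotate_rootSet k (pos_of_atLeastTwo k) t

theorem mk_rotLoop_eq :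
    Path.Homotopic.Quotient.mk (rotLoop k (k - 1) le_rfl (Nat.sub_le k 1)) =
      liftClass (dupLift (evenFace k)) (dupLift (shiftStrict (evenFace k)))
        subsetOf_dupLift_evenFace
        ((subsetOf_dupLift_shiftStrict _).trans subsetOf_dupLift_evenFace) := by
  refine mk_eq_liftClass _ _ (segPath _ _) _ fun t => StratumCompl.ext ?_
  refine (image_rotate_rootSet (k - 1) (sub_one_pos_of_atLeastTwo k) t).trans ?_
  exact (range_comp_dupIndex (k := k) (fun i => e ((1 - (t : ℝ)) * (evenFace k).1 i +
    t * (evenFace k).1 (i + 1)))).symm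

theorem dupIndex_of_lt {i : ℕ} (hi : i < k) : dupIndex k i = (i - 1 : ℕ) := by
  induction i with
  | zero => simp [dupIndex]
  | succ i ih =>
    rcases Nat.eq_zero_or_pos i with rfl | h
    · have := dupIndex_succ_of_dvd (k := k) (dvd_zero _)
      simpa [dupIndex] using this
    · push_cast
      rw [dupIndex_succ_of_not_dvd, ih (by omega)]
      · omega
      · intro hd
        have := Int.le_of_dvd (by omega) hd
        omega

theorem mk_gammaPath_eq : Path.Homotopic.Quotient.mk (gammaPath k) =
    liftClass (evenLift k) (dupLift (evenFace k)) subsetOf_evenLift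
      subsetOf_dupLift_evenFace := by
  have hk2 := two_le_of_atLeastTwo k
  refine mk_eq_liftClass _ _ (segPath _ _) _ fun t => Subtype.ext ?_
  rw [subsetOf_val]
  change ofTuple _ = ofTuple _
  congr 1
  funext i
  congr 1
  change _ = (1 - (t : ℝ)) * (evenLift k).1 (i : ℕ) + t * (evenFace k).1 (dupIndex k (i : ℕ))
  rw [dupIndex_of_lt i.2]
  simp [gammaTuple, evenLift, evenFace, evenStrict]

/-- If `γ` and `ρ` are images of paths of lifts, then so is `γ` followed by `ρ`, up to the change
of lift before returning along `γ`. -/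
theorem mk_conj_eq (z : LiftSeq k) (w : StrictSeq (k - 1)) {S T : StratumCompl k}
    (hS : subsetOf z = S) (hT : subsetOf (dupLift w) = T) (γ : Path S T) (ρ : Path T T)
    (hγ : Path.Homotopic.Quotient.mk γ = liftClass z (dupLift w) hS hT)
    (hρ : Path.Homotopic.Quotient.mk ρ = liftClass (dupLift w) (dupLift (shiftStrict w)) hT
      ((subsetOf_dupLift_shiftStrict w).trans hT)) :
    Path.Homotopic.Quotient.mk ((γ.trans ρ).trans γ.symm) =
      (liftClass z (dupLift (shiftStrict w)) hS (subsetOf_dupLift_shiftStrict w)).trans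
        (liftClass (dupLift w) z rfl hS) := by
  subst hT
  rw [Path.Homotopic.Quotient.mk_trans, Path.Homotopic.Quotient.mk_trans,
    Path.Homotopic.Quotient.mk_symm, hγ, hρ, liftClass_trans, liftClass_symm]

theorem mk_beta_eq : Path.Homotopic.Quotient.mk (beta k) =
    (liftClass (evenLift k) (dupLift (shiftStrict (evenFace k))) subsetOf_evenLift
      (subsetOf_dupLift_shiftStrict _)).trans
        (liftClass (dupLift (evenFace k)) _ rfl subsetOf_evenLift) :=
  mk_conj_eq (evenLift k) (evenFace k) subsetOf_evenLift subsetOf_dupLift_evenFace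
    (gammaPath k) _ mk_gammaPath_eq mk_rotLoop_eq

end

end CircleSubsets

end

theorem mainTheorem6 (k : ℕ) [k.AtLeastTwo] :
    ∃ Φ : CircleSubsets.TorusKnotGroup k ≃*
        FundamentalGroup (CircleSubsets.StratumCompl k) (CircleSubsets.basept k),
      Φ (PresentedGroup.of 0) =
          FundamentalGroup.fromPath (Path.Homotopic.Quotient.mk (CircleSubsets.alpha k)) ∧
      Φ (PresentedGroup.of 1) =
          FundamentalGroup.fromPath (Path.Homotopic.Quotient.mk (CircleSubsets.beta k)) :=
  CircleSubsets.exists_mulEquiv_of_eq_liftClass CircleSubsets.subsetOf_evenLift _ _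
    CircleSubsets.mk_alpha_eq CircleSubsets.mk_beta_eq
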